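/- **Setting.** Let $G$ be an adjoint simple group, split over $\mathbf F_q$, of type $B_n$ or $C_n$ ($n\ge 2$) or $D_n$ ($n\ge 4$), with Weyl group $W$, and let $c$ be a family of irreducible representations of $W$. *Families and symbols.* A symbol is an unordered pair of finite subsets (rows) $S,T$ of $\mathbf N$; it is taken reduced ($0\notin S\cap T$). Its defect is $\big||S|-|T|\big|$ and its rank is $\sum S+\sum T-\lfloor (\frac{|S|+|T|-1}{2})^2\rfloor$. In types $B_n,C_n$ the irreducible representations of $W$ are labelled by the symbols of rank $n$ and defect $1$; in type $D_n$ by those of rank $n$ and defect $0$, a degenerate symbol ($S=T$) being the label of two representations. A family $c$ consists of the representations whose symbols have a given multiset of entries, except that the two representations with a given degenerate symbol form two families of one element each. *The space $V$.* Let $z_1<z_2<\dots<z_N$ be the entries which occur only once, and let $D=N-1$ in types $B_n,C_n$, and $D=N-2$ in type $D_n$ ($D=0$ if $N=0$); $D$ is even. Let $V$ be the $\mathbf F_2$-vector space with basis $e_1,\dots,e_D$ and the symplectic form with $(e_i,e_j)=1$ if $i-j=\pm1$ and $(e_i,e_j)=0$ otherwise. To $x=\sum_i x_ie_i\in V$ we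 attach the symbol with these entries in which the single entries of one row form the symmetric difference of $\{z_2,z_4,\dots\}$ and of all $\{z_i,z_{i+1}\}$ with $x_i=1$. *$M(\mathcal G_c)$.* For a finite group $\Gamma$, $M(\Gamma)$ is the set of pairs $(x,\rho)$ ($x\in\Gamma$, $\rho$ an irreducible complex representation of the centralizer of $x$, up to isomorphism) modulo $\Gamma$-conjugacy, $\mathbf C[M(\Gamma)]$ is the vector space with basis $M(\Gamma)$, and $A_\Gamma$ is its non-abelian Fourier transform. An element $f\in\mathbf C[M(\Gamma)]$ is $\ge0$ if its coefficients are real and $\ge 0$, and bipositive if $f\ge0$ and $A_\Gamma(f)\ge0$. Choose a decomposition $V=L\oplus L'$ into isotropic subspaces (for instance those spanned by the $e_i$ with $i$ odd, respectively even); $\mathcal G_c$ is the group $L$, and $l+l'\in V$ is identified with $(l,(-1)^{(\cdot,l')})\in M(\mathcal G_c)$. Thus $V=M(\mathcal G_c)$, with $0=(1,1)$. Let $M_0(\mathcal G_c)$ be the set of $x\in V$ whose symbol belongs to $c$, and let $\mathbf C[M_0(\mathcal G_c)]$ be its span. *The set $\mathbf S_D$.* Intervals are the $[a,b]=\{a,a+1,\dots,b\}$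 with $1\le a\le b\le D$. For $i\in[1,D]$ and an interval $[a,b]$ of $[1,D-2]$ let $\xi_i[a,b]$ be $[a+2,b+2]$ if $i\le a$, $[a,b]$ if $i\ge b+2$, and $[a,b+2]$ if $a<i<b+2$; for a set $B'$ of intervals let $t_i(B')=\{\xi_i(I):I\in B'\}\sqcup\{\{i\}\}$. Let $\mathbf S_0=\{\emptyset\}$; for even $D\ge2$ let $\mathbf S_D$ consist of the sets $\{[1,D],[2,D-1],\dots,[k,D+1-k]\}$ with $0\le k\le D/2$ and of the sets $t_i(B')$ with $i\in[1,D]$, $B'\in\mathbf S_{D-2}$. Let $S_D\subset\mathbf S_D$ be defined in the same way, with only $k=0$ allowed. For $B\in\mathbf S_D$ let $\langle B\rangle\subset V$ be the span of the vectors $e_I=\sum_{i\in I}e_i$, $I\in B$. Let $\tilde{\mathbf B}_c\subset\mathbf C[M(\mathcal G_c)]$ be the set of characteristic functions of the subspaces $\langle B\rangle$, $B\in\mathbf S_D$, and let $\mathbf B_c$ be the set of characteristic functions of the $\langle B\rangle$, $B\in S_D$. **Theorem.** $\tilde{\mathbf B}_c$ is a basis of $\mathbf C[M(\mathcal G_c)]$,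 and: (I) for all $B\in\mathbf S_D$ the subspace $\langle B\rangle$ is isotropic, and all elements of $\tilde{\mathbf B}_c$ are bipositive. (II) There is a unique bijection $M(\mathcal G_c)\to\tilde{\mathbf B}_c$, $m\mapsto\hat m$, such that every $m$ occurs with nonzero coefficient in $\hat m$; this coefficient is $1$. (III) The transitive relation $\le$ on $M(\mathcal G_c)$ generated by the relation "$m$ occurs with nonzero coefficient in $\widehat{m'}$" between $m$ and $m'$ is a partial order, whose unique minimal element is $(1,1)$. In particular, for a suitable numbering of $M(\mathcal G_c)$ the matrix of coefficients of the $\hat m$ with respect to the basis $M(\mathcal G_c)$ is upper triangular, with $1$ on the diagonal and integer entries. (IV) $(1,1)$ occurs with coefficient $1$ in every element of $\tilde{\mathbf B}_c$. (V) $\tilde{\mathbf B}_c\cap\mathbf C[M_0(\mathcal G_c)]=\mathbf B_c$, and this is a basis of $\mathbf C[M_0(\mathcal G_c)]$. -/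

import Mathlib

namespace UnipotentBasis

noncomputable section

open Classical

/-! ## The set `M(Γ)` and the non-abelian Fourier transform of a finite group -/

/-- A pair `(x, ρ)`: an element `x` of `Γ` and an irreducible complex representation `ρ` of the
centralizer of `x`. -/
structure MPair (Γ : Type) [Group Γ] where
  x : Γ
  dim : ℕ
  ρ : Representation ℂ (Subgroup.centralizer ({x} : Set Γ)) (Fin dim → ℂ)
  irr : ρ.IsIrreducible

/-- Two pairs are related by `g ∈ Γ` if conjugation by `g` carries the first to the second, up to an
isomorphism of representations. -/
def MPair.Rel {Γ : Type} [Group Γ] (p q : MPair Γ) : Prop :=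
  ∃ (g : Γ) (φ : (Fin p.dim → ℂ) ≃ₗ[ℂ] (Fin q.dim → ℂ)), g * p.x * g⁻¹ = q.x ∧
    ∀ (z : Subgroup.centralizer ({p.x} : Set Γ)) (w : Subgroup.centralizer ({q.x} : Set Γ)),
      (w : Γ) = g * z * g⁻¹ → ∀ v, φ (p.ρ z v) = q.ρ w (φ v)

theorem conj_mem_centralizer {Γ : Type} [Group Γ] {x y g z : Γ} (h : g * x * g⁻¹ = y)
    (hz : z ∈ Subgroup.centralizer ({x} : Set Γ)) :
    g * z * g⁻¹ ∈ Subgroup.centralizer ({y} : Set Γ) := by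
  rw [Subgroup.mem_centralizer_singleton_iff] at hz ⊢
  subst h
  have e : g * z * g⁻¹ * (g * x * g⁻¹) = g * (z * x) * g⁻¹ := by group
  rw [e, hz]; group

instance MPair.setoid (Γ : Type) [Group Γ] : Setoid (MPair Γ) where
  r := MPair.Rel
  iseqv := by
    refine ⟨fun p => ?_, ?_, ?_⟩
    · refine ⟨1, LinearEquiv.refl ℂ _, by simp, fun z w h v => ?_⟩
      have : w = z := Subtype.ext (by simpa using h)
      simp [this]
    · rintro p q ⟨g, φ, hx, h⟩
      refine ⟨g⁻¹, φ.symm, by rw [← hx]; group, fun z w hw v => ?_⟩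
      have := h w z (by rw [hw]; group) (φ.symm v)
      rw [LinearEquiv.apply_symm_apply] at this
      rw [← this, LinearEquiv.symm_apply_apply]
    · rintro p q r ⟨g, φ, hx, h⟩ ⟨g', φ', hx', h'⟩
      refine ⟨g' * g, φ.trans φ', by rw [← hx', ← hx]; group, fun z w hw v => ?_⟩
      have h1 := h z ⟨g * z * g⁻¹, conj_mem_centralizer hx z.2⟩ rfl v
      have h2 := h' ⟨g * z * g⁻¹, conj_mem_centralizer hx z.2⟩ w (by rw [hw]; group) (φ v)
      simp only [LinearEquiv.trans_apply]
      rw [h1, h2]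

/-- `M(Γ)`: pairs `(x, ρ)` up to `Γ`-conjugacy (and isomorphism of `ρ`). -/
def M (Γ : Type) [Group Γ] : Type := Quotient (MPair.setoid Γ)

/-- The trace of `w` on `ρ` for `w` in the centralizer of `x` (and `0` for other `w`). -/
def MPair.tr {Γ : Type} [Group Γ] (p : MPair Γ) (w : Γ) : ℂ :=
  if h : w ∈ Subgroup.centralizer ({p.x} : Set Γ) then
    LinearMap.trace ℂ (Fin p.dim → ℂ) (p.ρ ⟨w, h⟩) else 0

/-- Lusztig's pairing
`{(x,σ),(y,τ)} = ∑_g |Z(x)|⁻¹ |Z(y)|⁻¹ Tr(g⁻¹ x⁻¹ g, τ) Tr(g y g⁻¹, σ)`,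
the sum over the `g ∈ Γ` such that `x` and `g y g⁻¹` commute. -/
def MPair.pairing {Γ : Type} [Group Γ] (p q : MPair Γ) : ℂ :=
  ∑ᶠ g : Γ, if p.x * (g * q.x * g⁻¹) = (g * q.x * g⁻¹) * p.x then
    (Nat.card (Subgroup.centralizer ({p.x} : Set Γ)) : ℂ)⁻¹ *
    (Nat.card (Subgroup.centralizer ({q.x} : Set Γ)) : ℂ)⁻¹ *
    q.tr (g⁻¹ * p.x⁻¹ * g) * p.tr (g * q.x * g⁻¹) else 0

/-- The coefficient of `m` in `A_Γ(f)`, where `A_Γ` is the non-abelian Fourier transform of the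
vector space `ℂ[M(Γ)]` with basis `M(Γ)`. The pairing only depends on the classes of the pairs. -/
def fourier {Γ : Type} [Group Γ] (f : M Γ →₀ ℂ) (m : M Γ) : ℂ :=
  f.sum fun m' a => a * MPair.pairing (Quotient.out m') (Quotient.out m)

/-- All coefficients are nonnegative real numbers. -/
def NonnegCoeffs {Γ : Type} [Group Γ] (f : M Γ → ℂ) : Prop :=
  ∀ m, ∃ r : ℝ, 0 ≤ r ∧ f m = r

/-- `f ≥ 0` and `A_Γ(f) ≥ 0`. -/
def Bipositive {Γ : Type} [Group Γ] (f : M Γ →₀ ℂ) : Prop :=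
  NonnegCoeffs (f : M Γ → ℂ) ∧ NonnegCoeffs (fourier f)

/-- The one-dimensional representation with character `χ`. -/
def oneDim {H : Type} [Group H] (χ : H →* ℂ) : Representation ℂ H (Fin 1 → ℂ) where
  toFun h := χ h • LinearMap.id
  map_one' := by ext; simp
  map_mul' a b := by ext; simp; ring

theorem oneDim_irreducible {H : Type} [Group H] (χ : H →* ℂ) : (oneDim χ).IsIrreducible := by
  have hs : IsSimpleOrder (Submodule ℂ (Fin 1 → ℂ)) :=
    (isSimpleModule_iff ℂ (Fin 1 → ℂ)).mp (isSimpleModule_iff_finrank_eq_one.mpr (by simp))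
  have key : ∀ σ : Subrepresentation (oneDim χ), σ = ⊥ ∨ σ = ⊤ := by
    intro σ
    rcases hs.eq_bot_or_eq_top σ.toSubmodule with h | h
    · left; exact Subrepresentation.toSubmodule_injective (by rw [h]; rfl)
    · right; exact Subrepresentation.toSubmodule_injective (by rw [h]; rfl)
  have hne : (⊥ : Subrepresentation (oneDim χ)) ≠ ⊤ := by
    intro h
    have : (⊥ : Submodule ℂ (Fin 1 → ℂ)) = ⊤ := congrArg Subrepresentation.toSubmodule h
    exact bot_ne_top this
  exact { exists_pair_ne := ⟨⊥, ⊤, hne⟩, eq_bot_or_eq_top := key }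

/-- The class of the pair `(x, χ)`, with `χ` a one-dimensional character of the centralizer. -/
def M.ofChar {Γ : Type} [Group Γ] (x : Γ) (χ : Subgroup.centralizer ({x} : Set Γ) →* ℂ) : M Γ :=
  Quotient.mk (MPair.setoid Γ) ⟨x, 1, oneDim χ, oneDim_irreducible χ⟩

/-- The element `(1, 1)` of `M(Γ)`. -/
def M.one (Γ : Type) [Group Γ] : M Γ := M.ofChar 1 1

/-! ## Intervals and the set `𝕊_D` -/

/-- The map `ξ_i` on intervals; the pair `(a, b)` stands for the interval `[a, b]`. -/
def xi (i : ℕ) (I : ℕ × ℕ) : ℕ × ℕ :=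
  if i ≤ I.1 then (I.1 + 2, I.2 + 2)
  else if I.2 + 2 ≤ i then (I.1, I.2)
  else (I.1, I.2 + 2)

/-- `t_i(B) = {ξ_i(I) ; I ∈ B} ⊔ {[i, i]}`. -/
def tMap (i : ℕ) (B : Finset (ℕ × ℕ)) : Finset (ℕ × ℕ) := insert (i, i) (B.image (xi i))

/-- The primitive set `{[1, D], [2, D - 1], …, [k, D + 1 - k]}` (used only for `k ≤ D / 2`). -/
def primSet (D k : ℕ) : Finset (ℕ × ℕ) := (Finset.Icc 1 k).image fun j => (j, D + 1 - j)

/-- `SD D B` says that `B` belongs to the set `𝕊_D` (`D` even). -/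
inductive SD : ℕ → Finset (ℕ × ℕ) → Prop
  | prim (D k : ℕ) (hD : Even D) (hk : k ≤ D / 2) : SD D (primSet D k)
  | step (D i : ℕ) (B : Finset (ℕ × ℕ)) (h1 : 1 ≤ i) (h2 : i ≤ D + 2) (hB : SD D B) :
      SD (D + 2) (tMap i B)

/-- `SD₀ D B` says that `B` belongs to the smaller set `S_D` (`D` even), in which only the empty set
is taken as primitive. -/
inductive SD₀ : ℕ → Finset (ℕ × ℕ) → Prop
  | empty (D : ℕ) (hD : Even D) : SD₀ D ∅
  | step (D i : ℕ) (B : Finset (ℕ × ℕ)) (h1 : 1 ≤ i) (h2 : i ≤ D + 2) (hB : SD₀ D B) :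
      SD₀ (D + 2) (tMap i B)

/-! ## The symplectic space `V` -/

/-- The `𝔽₂`-vector space with basis `e_1, …, e_D`; the coordinate `j : Fin D` belongs to
`e_{j+1}`. -/
abbrev V (D : ℕ) : Type := Fin D → ZMod 2

/-- `(e_i, e_j) = 1` if `i - j = ±1`, and `0` otherwise. -/
def form (D : ℕ) : LinearMap.BilinForm (ZMod 2) (V D) :=
  Matrix.toBilin' (Matrix.of fun i j : Fin D =>
    if (i : ℕ) = j + 1 ∨ (j : ℕ) = i + 1 then 1 else 0)

def Isotropic {D : ℕ} (E : Submodule (ZMod 2) (V D)) : Prop :=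
  ∀ x ∈ E, ∀ y ∈ E, form D x y = 0

/-- `e_I`, the sum of the `e_i` with `i ∈ I = [a, b]`. -/
def eInt (D : ℕ) (I : ℕ × ℕ) : V D := fun j => if I.1 ≤ j + 1 ∧ (j : ℕ) + 1 ≤ I.2 then 1 else 0

/-- `⟨B⟩`, the subspace generated by the `e_I`, `I ∈ B`. -/
def bracket (D : ℕ) (B : Finset (ℕ × ℕ)) : Submodule (ZMod 2) (V D) :=
  Submodule.span (ZMod 2) (eInt D '' (B : Set (ℕ × ℕ)))

/-! ## The identification of `V` with `M(𝒢)`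

For a decomposition `V = L ⊕ L'` into isotropic subspaces, `𝒢` is the group `L` (written
multiplicatively), `L'` is the character group of `L` through the symplectic form, and
`l + l'` corresponds to the pair `(l, (-1)^{( · , l')})`. -/

/-- `(-1)^a`. -/
def sgn (a : ZMod 2) : ℂ := if a = 0 then 1 else -1

theorem sgn_add (a b : ZMod 2) : sgn (a + b) = sgn a * sgn b := by
  have h : ∀ a : ZMod 2, a = 0 ∨ a = 1 := by decide
  have h2 : (1 + 1 : ZMod 2) = 0 := by decide
  rcases h a with rfl | rfl <;> rcases h b with rfl | rfl <;> simp [sgn, h2]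

/-- The group `𝒢`. -/
abbrev Gp {D : ℕ} (L : Submodule (ZMod 2) (V D)) : Type := Multiplicative L

/-- The character `z ↦ (-1)^{(z, y)}` on a subgroup of `𝒢`. -/
def charOf {D : ℕ} {L : Submodule (ZMod 2) (V D)} (y : V D) (H : Subgroup (Gp L)) : H →* ℂ where
  toFun h := sgn (form D ((Multiplicative.toAdd (h : Gp L) : L) : V D) y)
  map_one' := by simp [sgn]
  map_mul' a b := by simp [sgn_add]

/-- The map `V → M(𝒢)`. -/
def iota {D : ℕ} {L L' : Submodule (ZMod 2) (V D)} (h : IsCompl L L') (v : V D) : M (Gp L) :=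
  M.ofChar (Multiplicative.ofAdd (L.projectionOnto L' h v))
    (charOf (L'.projectionOnto L h.symm v : V D) _)

/-- The characteristic function of the subspace `⟨B⟩`, as an element of `ℂ[M(𝒢)]`. -/
def charFun {D : ℕ} {L L' : Submodule (ZMod 2) (V D)} (h : IsCompl L L')
    (B : Finset (ℕ × ℕ)) : M (Gp L) →₀ ℂ :=
  ∑ v : V D, if v ∈ bracket D B then Finsupp.single (iota h v) 1 else 0

/-- The new basis. -/
def newBasis {D : ℕ} {L L' : Submodule (ZMod 2) (V D)} (h : IsCompl L L') :
    Set (M (Gp L) →₀ ℂ) := {f | ∃ B, SD D B ∧ f = charFun h B}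

/-- The earlier basis, indexed by `S_D`. -/
def oldBasis {D : ℕ} {L L' : Submodule (ZMod 2) (V D)} (h : IsCompl L L') :
    Set (M (Gp L) →₀ ℂ) := {f | ∃ B, SD₀ D B ∧ f = charFun h B}

/-- The transitive relation on `M(Γ)` generated by: `m` occurs with nonzero coefficient in
`hat m'`. -/
def coeffOrder {Γ : Type} [Group Γ] (hat : M Γ → (M Γ →₀ ℂ)) : M Γ → M Γ → Prop :=
  Relation.TransGen fun m m' => hat m' m ≠ 0

/-! ## Families and symbols -/

inductive ClassicalType
  | B | C | D

/-- The smallest rank considered for the type. -/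
def ClassicalType.minRank : ClassicalType → ℕ
  | .B => 2 | .C => 2 | .D => 4

/-- The defect of the symbols that label the irreducible representations of the Weyl group. -/
def ClassicalType.defect : ClassicalType → ℕ
  | .B => 1 | .C => 1 | .D => 0

/-- Symbols: unordered pairs of finite subsets of `ℕ`. -/
abbrev LSymbol : Type := Sym2 (Finset ℕ)

def LSymbol.entries : LSymbol → Multiset ℕ :=
  Sym2.lift ⟨fun S T => S.val + T.val, fun _ _ => add_comm _ _⟩

def LSymbol.defect : LSymbol → ℕ :=
  Sym2.lift ⟨fun S T => ((S.card : ℤ) - T.card).natAbs, fun _ _ => by dsimp only; omega⟩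

/-- `Λ` is reduced (`0` does not occur in both rows; every shift class of symbols has exactly one
reduced member), of rank `n` and of the defect belonging to the type. In types `B`, `C` these symbols
label the irreducible representations of the Weyl group `W`. In type `D` they do too, except that a
degenerate symbol (one with equal rows) labels two of them. -/
def IsWeylSymbol (t : ClassicalType) (n : ℕ) (Λ : LSymbol) : Prop :=
  Λ.entries.count 0 ≤ 1 ∧
  Λ.entries.sum = n + (Multiset.card Λ.entries - 1) ^ 2 / 4 ∧
  Λ.defect = t.defect

/-- The family of `Λ`: all symbols of the same rank and defect with the same entries. (In type `D`
a degenerate symbol stands for two families, with one element each.) -/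
def family (t : ClassicalType) (n : ℕ) (Λ : LSymbol) : Set LSymbol :=
  {Λ' | IsWeylSymbol t n Λ' ∧ Λ'.entries = Λ.entries}

/-- The entries that occur once. -/
def LSymbol.singles (Λ : LSymbol) : Finset ℕ :=
  Λ.entries.toFinset.filter fun z => Λ.entries.count z = 1

/-- The entries that occur in both rows. -/
def LSymbol.doubles (Λ : LSymbol) : Finset ℕ :=
  Λ.entries.toFinset.filter fun z => Λ.entries.count z = 2

/-- The even number `D` attached to the family of `Λ`: the number of singles is `D + 1` in types `B`,
`C`, and it is `D + 2` in type `D` (where `D = 0` if there are no singles). -/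
def famD (Λ : LSymbol) : ℕ := 2 * ((Λ.singles.card - 1) / 2)

/-- For `z` the `p`-th smallest single `z_p`, this is `p`. -/
def LSymbol.pos (Λ : LSymbol) (z : ℕ) : ℕ := (Λ.singles.filter (· ≤ z)).card

/-- The set of singles in the second row of the symbol attached to `x ∈ V`: the symmetric difference
of `{z_2, z_4, …}` (the singles of the second row of the special symbol) and of the sets
`{z_i, z_{i+1}}` for all `i` such that `e_i` occurs in `x`. -/
def secondRow (Λ : LSymbol) (x : V (famD Λ)) : Finset ℕ :=
  Λ.singles.filter fun z =>
    (if Even (Λ.pos z) then (1 : ZMod 2) else 0) +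
      (∑ i : Fin (famD Λ), if Λ.pos z = i + 1 ∨ Λ.pos z = i + 2 then x i else 0) = 1

/-- The symbol attached to `x ∈ V`. -/
def symbolOf (Λ : LSymbol) (x : V (famD Λ)) : LSymbol :=
  s(Λ.doubles ∪ (Λ.singles \ secondRow Λ x), Λ.doubles ∪ secondRow Λ x)

/-- `M₀(𝒢)`, the image of the family of `Λ` in `M(𝒢)`. -/
def M₀ (t : ClassicalType) (n : ℕ) (Λ : LSymbol) {L L' : Submodule (ZMod 2) (V (famD Λ))}
    (h : IsCompl L L') : Set (M (Gp L)) :=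
  iota h '' {x | symbolOf Λ x ∈ family t n Λ}

end

end UnipotentBasis

open UnipotentBasis

namespace UnipotentBasis

noncomputable section

/-! ## Binary sequences and their walks -/

/-! A vector `x` of `V` is read as a walk with `D + 1` steps `±1`: the `q`-th step tells in which
row of the symbol of `x` the single `z_{q+1}` stands. The balance at `p` is the sum of the first `p`
steps minus the sum of the others. Balances are odd, and their absolute values determine `x`
(`eq_of_abs_balance_eq`).

The operation `t_i` on sets of intervals becomes the insertion of two opposite steps, a peak, at a
fixed place of the walk: `⟨t_i(B)⟩` consists of the vectors of `⟨B⟩` with a peak inserted, up or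
down. If the peak points away from `0`, absolute balances grow as much as possible. Hence each `⟨B⟩`
contains a leading vector, at which all absolute balances are simultaneously maximal
(`IsLeading.abs_balance_le`); for the primitive sets it is `primVec`.

Conversely, outward peaks can be removed from any vector until none is left, and the vectors without
outward peaks are exactly the `primVec D k`. So every vector is a leading vector
(`exists_isLeading`). Distinct peaks commute, so the set `B` does not depend on the order of removal
(`IsLeading.unique`). This gives the bijection between `V` and `𝕊_D`.

With respect to the sum of the absolute balances the coefficient matrix is unitriangular, which
yields the basis, the uniqueness of the bijection and the partial order. The symbol of `x` lies in
the family exactly when the balance at `0` is `±1`, its least possible absolute value. This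
condition therefore passes from a leading vector to all of `⟨B⟩`, and it singles out the sets grown
from `∅`; this is (V). Bipositivity holds because `A_Γ` becomes the symplectic Fourier transform on
`V`, and a character sum over a subspace is `0` or the order of the subspace. -/

/-- The sign `(-1)^a` as an integer. -/
def sgz (a : ZMod 2) : ℤ := if a = 0 then 1 else -1

theorem zmod2_cases (a : ZMod 2) : a = 0 ∨ a = 1 := by revert a; decide

theorem sgz_add (a b : ZMod 2) : sgz (a + b) = sgz a * sgz b := by
  revert a b; decide

theorem sgz_cases (a : ZMod 2) : sgz a = 1 ∨ sgz a = -1 := by revert a; decide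

theorem sgz_injective : Function.Injective sgz := by decide

theorem zmod2_add_self (a : ZMod 2) : a + a = 0 := by revert a; decide

/-- Sequences that vanish outside `[1, D]`. -/
def SuppIn (D : ℕ) (x : ℕ → ZMod 2) : Prop := x 0 = 0 ∧ ∀ p, D < p → x p = 0

/-- The `q`-th step of the walk of `x`. -/
def stepSign (x : ℕ → ZMod 2) (q : ℕ) : ℤ := (-1) ^ q * sgz (x q + x (q + 1))

def walk (x : ℕ → ZMod 2) (p : ℕ) : ℤ := ∑ q ∈ Finset.range p, stepSign x q

/-- The difference of the sum of the first `p` steps and of the sum of the other steps, among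
`D + 1` steps. -/
def balance (D : ℕ) (x : ℕ → ZMod 2) (p : ℕ) : ℤ := 2 * walk x p - walk x (D + 1)

theorem neg_one_pow_cases (q : ℕ) : ((-1 : ℤ) ^ q = 1) ∨ ((-1 : ℤ) ^ q = -1) :=
  neg_one_pow_eq_or ℤ q

theorem stepSign_cases (x : ℕ → ZMod 2) (q : ℕ) : stepSign x q = 1 ∨ stepSign x q = -1 := by
  unfold stepSign
  rcases neg_one_pow_cases q with h | h <;> rcases sgz_cases (x q + x (q + 1)) with h' | h' <;>
    simp [h, h']

theorem walk_zero (x : ℕ → ZMod 2) : walk x 0 = 0 := by simp [walk]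

theorem walk_succ (x : ℕ → ZMod 2) (p : ℕ) : walk x (p + 1) = walk x p + stepSign x p := by
  simp [walk, Finset.sum_range_succ]

theorem balance_succ (D : ℕ) (x : ℕ → ZMod 2) (p : ℕ) :
    balance D x (p + 1) = balance D x p + 2 * stepSign x p := by
  simp [balance, walk_succ]; ring

theorem balance_zero (D : ℕ) (x : ℕ → ZMod 2) : balance D x 0 = - walk x (D + 1) := by
  simp [balance, walk_zero]

theorem balance_last (D : ℕ) (x : ℕ → ZMod 2) : balance D x (D + 1) = walk x (D + 1) := by
  simp [balance]; ring

theorem walk_parity (x : ℕ → ZMod 2) (p : ℕ) : ∃ m, walk x p = p + 2 * m := by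
  induction p with
  | zero => exact ⟨0, by simp [walk_zero]⟩
  | succ p ih =>
    obtain ⟨m, hm⟩ := ih
    rcases stepSign_cases x p with h | h
    · exact ⟨m, by rw [walk_succ, hm, h]; push_cast; ring⟩
    · exact ⟨m - 1, by rw [walk_succ, hm, h]; push_cast; ring⟩

theorem balance_odd {D : ℕ} (hD : Even D) (x : ℕ → ZMod 2) (p : ℕ) :
    ∃ m, balance D x p = 2 * m + 1 := by
  obtain ⟨m, hm⟩ := walk_parity x (D + 1)
  obtain ⟨d, rfl⟩ := hD
  exact ⟨walk x p - d - 1 - m, by rw [balance, hm]; push_cast; ring⟩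

/-- The absolute values of the balances determine a sequence. -/
theorem eq_of_abs_balance_eq {D : ℕ} (hD : Even D) {x y : ℕ → ZMod 2} (hx : SuppIn D x)
    (hy : SuppIn D y) (h : ∀ p ≤ D + 1, |balance D x p| = |balance D y p|) : x = y := by
  have step : ∀ p ≤ D, (balance D x p = balance D y p → stepSign x p = stepSign y p) ∧
      (balance D x p = - balance D y p → stepSign x p = - stepSign y p) := by
    intro p hp
    have h1 := h (p + 1) (by omega)
    obtain ⟨m, hm⟩ := balance_odd hD y p
    rw [balance_succ, balance_succ, abs_eq_abs] at h1
    rcases stepSign_cases x p with hs | hs <;> rcases stepSign_cases y p with hs' | hs' <;>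
      rw [hs, hs'] at h1 ⊢ <;> omega
  -- An odd number `b` is nonzero, so `b + 2` and `b - 2` have different absolute values. Hence the
  -- relative sign of the two balances cannot change along the walk, and its value at `0` decides.
  rcases abs_eq_abs.1 (h 0 (by omega)) with h0 | h0
  · have key : ∀ p ≤ D + 1, balance D x p = balance D y p := by
      intro p
      induction p with
      | zero => exact fun _ => h0
      | succ p ih =>
        intro hp
        rw [balance_succ, balance_succ, ih (by omega), (step p (by omega)).1 (ih (by omega))]
    have bits : ∀ p ≤ D + 1, x p = y p := by
      intro p
      induction p with
      | zero => intro _; rw [hx.1, hy.1]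
      | succ p ih =>
        intro hp
        have h1 := (step p (by omega)).1 (key p (by omega))
        unfold stepSign at h1
        have h2 := sgz_injective (mul_left_cancel₀ (by positivity) h1)
        rw [ih (by omega)] at h2
        exact add_left_cancel h2
    funext p
    rcases Nat.lt_or_ge D p with hp | hp
    · rw [hx.2 p hp, hy.2 p hp]
    · exact bits p (by omega)
  -- If all steps are opposite, `x p + y p` alternates with the parity of `p`, but at the odd index
  -- `D + 1` both terms vanish.
  · exfalso
    have key : ∀ p ≤ D + 1, balance D x p = - balance D y p := by
      intro p
      induction p with
      | zero => exact fun _ => h0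
      | succ p ih =>
        intro hp
        rw [balance_succ, balance_succ, ih (by omega), (step p (by omega)).2 (ih (by omega))]
        ring
    have bits : ∀ p ≤ D + 1, x p + y p = p := by
      intro p
      induction p with
      | zero => intro _; rw [hx.1, hy.1]; simp
      | succ p ih =>
        intro hp
        have h1 := (step p (by omega)).2 (key p (by omega))
        unfold stepSign at h1
        have h2 : sgz (x p + x (p + 1)) = sgz (y p + y (p + 1) + 1) := by
          apply mul_left_cancel₀ (a := (-1 : ℤ) ^ p) (by positivity)
          rw [h1, sgz_add _ 1]; simp [sgz]
        have h3 := sgz_injective h2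
        have h4 := ih (by omega)
        push_cast
        rw [← h4]
        generalize x p = a at *
        generalize x (p + 1) = b at *
        generalize y p = c at *
        generalize y (p + 1) = d at *
        clear * - h3
        revert h3
        revert a b c d
        decide
    have h1 := bits (D + 1) le_rfl
    rw [hx.2 _ (by omega), hy.2 _ (by omega)] at h1
    obtain ⟨d, rfl⟩ := hD
    push_cast at h1
    rw [zmod2_add_self (d : ZMod 2), add_zero, zero_add] at h1
    exact zero_ne_one h1

/-! ## Insertion of a peak -/

/-- The sequence obtained by replacing the term `x (i - 1)` by three terms with the same value, and
adding `c` to the middle one. -/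
def ins (i : ℕ) (c : ZMod 2) (x : ℕ → ZMod 2) (p : ℕ) : ZMod 2 :=
  if p < i then x p else if p = i then x (i - 1) + c else x (p - 2)

theorem ins_add (i : ℕ) (c c' : ZMod 2) (x y : ℕ → ZMod 2) :
    ins i c x + ins i c' y = ins i (c + c') (x + y) := by
  funext p
  simp only [Pi.add_apply, ins]
  split_ifs <;> [rfl; ring; rfl]

theorem stepSign_ins_lt {i q : ℕ} (c : ZMod 2) (x : ℕ → ZMod 2) (hq : q + 1 < i) :
    stepSign (ins i c x) q = stepSign x q := by
  have h1 : q < i := by omega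
  simp [stepSign, ins, h1, hq]

/-- The inserted steps `i` and `i + 1` are opposite, and later steps move by two places, which
preserves the sign `(-1)^q`. So the walk gains one peak or valley, with direction given by `c`, and
keeps all its other heights. -/
theorem stepSign_ins_pred {i : ℕ} (c : ZMod 2) (x : ℕ → ZMod 2) :
    stepSign (ins (i + 1) c x) i = (-1) ^ i * sgz c := by
  simp [stepSign, ins, ← add_assoc, zmod2_add_self]

theorem stepSign_ins_self {i : ℕ} (c : ZMod 2) (x : ℕ → ZMod 2) :
    stepSign (ins (i + 1) c x) (i + 1) = - ((-1) ^ i * sgz c) := by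
  have h : x i + c + x i = c := by rw [add_right_comm, zmod2_add_self, zero_add]
  simp [stepSign, ins, h, pow_succ]

theorem stepSign_ins_gt {i q : ℕ} (c : ZMod 2) (x : ℕ → ZMod 2) (hq : i ≤ q) :
    stepSign (ins (i + 1) c x) (q + 2) = stepSign x q := by
  have h1 : ¬ q + 2 < i + 1 := by omega
  have h2 : ¬ q + 2 = i + 1 := by omega
  have h3 : ¬ q + 2 + 1 < i + 1 := by omega
  have h4 : ¬ q + 2 + 1 = i + 1 := by omega
  have h5 : q + 2 + 1 - 2 = q + 1 := by omega
  simp only [stepSign, ins, if_neg h1, if_neg h2, if_neg h3, if_neg h4, h5, Nat.add_sub_cancel,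
    pow_add]
  norm_num

theorem walk_ins_le {i : ℕ} (c : ZMod 2) (x : ℕ → ZMod 2) {p : ℕ} (hp : p ≤ i) :
    walk (ins (i + 1) c x) p = walk x p := by
  refine Finset.sum_congr rfl fun q hq => stepSign_ins_lt c x ?_
  have := Finset.mem_range.1 hq
  omega

theorem walk_ins_peak (i : ℕ) (c : ZMod 2) (x : ℕ → ZMod 2) :
    walk (ins (i + 1) c x) (i + 1) = walk x i + (-1) ^ i * sgz c := by
  rw [walk_succ, walk_ins_le c x le_rfl, stepSign_ins_pred]

theorem walk_ins_gt {i : ℕ} (c : ZMod 2) (x : ℕ → ZMod 2) {p : ℕ} (hp : i ≤ p) :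
    walk (ins (i + 1) c x) (p + 2) = walk x p := by
  induction p, hp using Nat.le_induction with
  | base => rw [walk_succ, walk_ins_peak, stepSign_ins_self]; ring
  | succ p hp ih =>
    rw [show p + 1 + 2 = p + 2 + 1 by ring, walk_succ, ih, stepSign_ins_gt c x hp, walk_succ]

theorem balance_ins_le {D i : ℕ} (hi : i ≤ D + 1) (c : ZMod 2) (x : ℕ → ZMod 2) {p : ℕ}
    (hp : p ≤ i) : balance (D + 2) (ins (i + 1) c x) p = balance D x p := by
  rw [balance, balance, walk_ins_le c x hp, show D + 2 + 1 = D + 1 + 2 by ring, walk_ins_gt c x hi]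

theorem balance_ins_peak {D i : ℕ} (hi : i ≤ D + 1) (c : ZMod 2) (x : ℕ → ZMod 2) :
    balance (D + 2) (ins (i + 1) c x) (i + 1) = balance D x i + 2 * ((-1) ^ i * sgz c) := by
  rw [balance, balance, walk_ins_peak, show D + 2 + 1 = D + 1 + 2 by ring, walk_ins_gt c x hi]; ring

theorem balance_ins_gt {D i : ℕ} (hi : i ≤ D + 1) (c : ZMod 2) (x : ℕ → ZMod 2) {p : ℕ}
    (hp : i ≤ p) : balance (D + 2) (ins (i + 1) c x) (p + 2) = balance D x p := by
  rw [balance, balance, walk_ins_gt c x hp, show D + 2 + 1 = D + 1 + 2 by ring, walk_ins_gt c x hi]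

theorem SuppIn.add {D : ℕ} {x y : ℕ → ZMod 2} (hx : SuppIn D x) (hy : SuppIn D y) :
    SuppIn D (x + y) :=
  ⟨by simp [hx.1, hy.1], fun p hp => by simp [hx.2 p hp, hy.2 p hp]⟩

theorem SuppIn.zero (D : ℕ) : SuppIn D 0 := ⟨rfl, fun _ _ => rfl⟩

/-- A sequence in which the neighbours of the `i`-th term agree is an insertion. -/
theorem exists_eq_ins {D i : ℕ} {x : ℕ → ZMod 2} (hx : SuppIn (D + 2) x) (h1 : 1 ≤ i)
    (h2 : i ≤ D + 2) (h : x (i - 1) = x (i + 1)) :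
    ∃ y c, SuppIn D y ∧ x = ins i c y := by
  refine ⟨fun p => if p < i then x p else x (p + 2), x (i - 1) + x i, ⟨?_, fun p hp => ?_⟩, ?_⟩
  · simp [show 0 < i by omega, hx.1]
  · rcases Nat.lt_or_ge p i with h3 | h3
    · have : p = i - 1 := by omega
      subst this
      simp only [if_pos h3, h]
      exact hx.2 _ (by omega)
    · simp only [if_neg (not_lt.2 h3)]
      exact hx.2 _ (by omega)
  · funext p
    simp only [ins]
    split_ifs with h3 h4 h5 h6
    · rfl
    · rw [← add_assoc, zmod2_add_self, zero_add, h4]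
    · omega
    · have : p = i + 1 := by omega
      subst this
      exact h.symm
    · congr 1; omega

theorem ins_injective {i : ℕ} {c c' : ZMod 2} {x y : ℕ → ZMod 2}
    (h : ins i c x = ins i c' y) : x = y := by
  funext p
  rcases Nat.lt_or_ge p i with hp | hp
  · simpa [ins, hp] using congrFun h p
  · simpa [ins, show ¬ p + 2 < i by omega, show ¬ p + 2 = i by omega] using congrFun h (p + 2)

theorem ins_comm {i j : ℕ} (h1 : 1 ≤ i) (hij : i ≤ j) (c c' : ZMod 2) (x : ℕ → ZMod 2) :
    ins (j + 2) c (ins i c' x) = ins i c' (ins j c x) := by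
  funext p
  simp only [ins]
  split_ifs <;> first | omega | rfl

/-! ## Intervals -/

/-- The indicator sequence of an interval. -/
def indic (I : ℕ × ℕ) (p : ℕ) : ZMod 2 := if I.1 ≤ p ∧ p ≤ I.2 then 1 else 0

/-- The span of the indicators of the intervals in `B`. -/
def seqSpan (B : Finset (ℕ × ℕ)) : Submodule (ZMod 2) (ℕ → ZMod 2) :=
  Submodule.span (ZMod 2) (indic '' (B : Set (ℕ × ℕ)))

/-- The indicator of `[a, b]` jumps only at `a - 1` and `b`. This is why the pairs `{a, b + 1}`
matter: if they are disjoint, the jump sets are disjoint and the vectors are orthogonal. -/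
theorem indic_add_succ {I : ℕ × ℕ} (hI : I.1 ≤ I.2) (q : ℕ) :
    indic I q + indic I (q + 1) = (if q + 1 = I.1 then 1 else 0) + (if q = I.2 then 1 else 0) := by
  have h2 : (1 + 1 : ZMod 2) = 0 := by decide
  simp only [indic]
  split_ifs <;> first | omega | simp [h2]

/-- The three cases of `xi` say that the value at `i - 1` is repeated twice more. Together with
`indic_single` this translates `tMap` into insertions. -/
theorem indic_xi {i : ℕ} {I : ℕ × ℕ} (h1 : 1 ≤ I.1) :
    indic (xi i I) = ins i 0 (indic I) := by
  funext p
  simp only [indic, ins, xi]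
  split_ifs <;> first | rfl | (exfalso; dsimp only at *; omega)

theorem indic_single (i : ℕ) : indic (i, i) = ins i 1 0 := by
  funext p
  simp only [indic, ins]
  split_ifs <;> first | rfl | omega

theorem indic_suppIn {D : ℕ} {I : ℕ × ℕ} (h1 : 1 ≤ I.1) (h2 : I.2 ≤ D) : SuppIn D (indic I) := by
  refine ⟨if_neg (by omega), fun p hp => if_neg (by omega)⟩

/-- The intervals of `B` lie in `[1, D]`, and the pairs `{a, b + 1}` attached to the intervals
`[a, b]` of `B` are disjoint. -/
structure Separated (D : ℕ) (B : Finset (ℕ × ℕ)) : Prop where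
  bounds : ∀ I ∈ B, 1 ≤ I.1 ∧ I.1 ≤ I.2 ∧ I.2 ≤ D
  disj : ∀ I ∈ B, ∀ J ∈ B, I ≠ J →
    I.1 ≠ J.1 ∧ I.2 ≠ J.2 ∧ I.1 ≠ J.2 + 1 ∧ J.1 ≠ I.2 + 1

theorem separated_primSet {D k : ℕ} (hk : k ≤ D / 2) : Separated D (primSet D k) := by
  constructor
  · intro I hI
    obtain ⟨j, hj, rfl⟩ := Finset.mem_image.1 hI
    have := Finset.mem_Icc.1 hj
    dsimp only
    omega
  · intro I hI J hJ hne
    obtain ⟨j, hj, rfl⟩ := Finset.mem_image.1 hI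
    obtain ⟨l, hl, rfl⟩ := Finset.mem_image.1 hJ
    have h1 := Finset.mem_Icc.1 hj
    have h2 := Finset.mem_Icc.1 hl
    have h3 : j ≠ l := by rintro rfl; exact hne rfl
    dsimp only
    omega

theorem Separated.tMap {D i : ℕ} {B : Finset (ℕ × ℕ)} (h : Separated D B) (h1 : 1 ≤ i)
    (h2 : i ≤ D + 2) : Separated (D + 2) (tMap i B) := by
  have mem : ∀ I ∈ UnipotentBasis.tMap i B, I = (i, i) ∨ ∃ J ∈ B, xi i J = I := by
    intro I hI
    simpa [UnipotentBasis.tMap] using hI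
  constructor
  · intro I hI
    rcases mem I hI with rfl | ⟨J, hJ, rfl⟩
    · dsimp only; omega
    · have := h.bounds J hJ
      unfold xi
      split_ifs <;> dsimp only <;> omega
  · intro I hI J hJ hne
    rcases mem I hI with rfl | ⟨I', hI', rfl⟩ <;> rcases mem J hJ with rfl | ⟨J', hJ', rfl⟩
    · exact absurd rfl hne
    · have := h.bounds J' hJ'
      unfold xi
      split_ifs <;> dsimp only <;> omega
    · have := h.bounds I' hI'
      unfold xi
      split_ifs <;> dsimp only <;> omega
    · have a1 := h.bounds J' hJ'
      have a2 := h.bounds I' hI'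
      have a3 := h.disj I' hI' J' hJ' (by rintro rfl; exact hne rfl)
      unfold xi
      split_ifs <;> dsimp only <;> omega

theorem SD.separated {D : ℕ} {B : Finset (ℕ × ℕ)} (h : SD D B) : Separated D B := by
  induction h with
  | prim D k hD hk => exact separated_primSet hk
  | step D i B h1 h2 _ ih => exact ih.tMap h1 h2

/-- Two peaks at different places can be inserted in either order; the index of the right one is
shifted by `2` if the left one is already there. It parallels `ins_comm`, and the uniqueness
argument needs both. -/
theorem tMap_comm {i j : ℕ} (hij : i ≤ j) (B : Finset (ℕ × ℕ)) :
    tMap (j + 2) (tMap i B) = tMap i (tMap j B) := by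
  have h1 : xi (j + 2) (i, i) = (i, i) := by
    unfold xi; split_ifs <;> first | rfl | (exfalso; dsimp only at *; omega)
  have h2 : xi i (j, j) = (j + 2, j + 2) := by
    exact if_pos hij
  have h3 : ∀ I, xi (j + 2) (xi i I) = xi i (xi j I) := by
    intro I
    unfold xi
    split_ifs <;> first | rfl | (exfalso; dsimp only at *; omega)
  simp only [tMap, Finset.image_insert, h1, h2, Finset.image_image, Finset.insert_comm (j + 2, j + 2)]
  congr 3
  funext I
  exact h3 I

theorem ins_mem_seqSpan_tMap {D i : ℕ} {B : Finset (ℕ × ℕ)} (hB : Separated D B)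
    {x : ℕ → ZMod 2} (hx : x ∈ seqSpan B) (c : ZMod 2) : ins i c x ∈ seqSpan (tMap i B) := by
  have base : ∀ c, ins i c 0 ∈ seqSpan (tMap i B) := by
    intro c
    rcases zmod2_cases c with rfl | rfl
    · have : ins i 0 0 = 0 := by funext p; simp [ins]
      rw [this]; exact zero_mem _
    · rw [← indic_single]
      exact Submodule.subset_span ⟨_, by simp [tMap], rfl⟩
  have h0 : ins i 0 x ∈ seqSpan (tMap i B) := by
    induction hx using Submodule.span_induction with
    | mem x hx =>
      obtain ⟨I, hI, rfl⟩ := hx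
      rw [← indic_xi (hB.bounds I hI).1]
      exact Submodule.subset_span
        ⟨_, by simpa [tMap] using Or.inr ⟨I.1, I.2, hI, rfl⟩, rfl⟩
    | zero => exact base 0
    | add x y _ _ hx hy => simpa [ins_add] using add_mem hx hy
    | smul a x _ hx =>
      rcases zmod2_cases a with rfl | rfl
      · simpa using base 0
      · simpa using hx
  simpa [ins_add] using add_mem h0 (base c)

theorem exists_of_mem_seqSpan_tMap {D i : ℕ} {B : Finset (ℕ × ℕ)} (hB : Separated D B)
    {w : ℕ → ZMod 2} (hw : w ∈ seqSpan (tMap i B)) : ∃ x ∈ seqSpan B, ∃ c, w = ins i c x := by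
  induction hw using Submodule.span_induction with
  | mem x hx =>
    obtain ⟨I, hI, rfl⟩ := hx
    have hI' : I = (i, i) ∨ ∃ J ∈ B, xi i J = I := by simpa [tMap] using hI
    rcases hI' with rfl | ⟨J, hJ, rfl⟩
    · exact ⟨0, zero_mem _, 1, indic_single i⟩
    · exact ⟨_, Submodule.subset_span ⟨J, hJ, rfl⟩, 0, indic_xi (hB.bounds J hJ).1⟩
  | zero => exact ⟨0, zero_mem _, 0, by funext p; simp [ins]⟩
  | add x y _ _ hx hy =>
    obtain ⟨x', hx', c, rfl⟩ := hx
    obtain ⟨y', hy', d, rfl⟩ := hy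
    exact ⟨x' + y', add_mem hx' hy', c + d, ins_add _ _ _ _ _⟩
  | smul a x _ hx =>
    rcases zmod2_cases a with rfl | rfl
    · exact ⟨0, zero_mem _, 0, by funext p; simp [ins]⟩
    · simpa using hx

theorem Separated.suppIn {D : ℕ} {B : Finset (ℕ × ℕ)} (hB : Separated D B) {w : ℕ → ZMod 2}
    (hw : w ∈ seqSpan B) : SuppIn D w := by
  induction hw using Submodule.span_induction with
  | mem x hx =>
    obtain ⟨I, hI, rfl⟩ := hx
    exact indic_suppIn (hB.bounds I hI).1 (hB.bounds I hI).2.2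
  | zero => exact SuppIn.zero D
  | add x y _ _ hx hy => exact hx.add hy
  | smul a x _ hx =>
    rcases zmod2_cases a with rfl | rfl
    · simpa using SuppIn.zero D
    · simpa using hx

/-! ## Primitive sets -/

/-- The vector of the subspace attached to `primSet D k` whose balances have the largest absolute
values. -/
def primVec (D k p : ℕ) : ZMod 2 :=
  ∑ j ∈ Finset.Icc 1 k, if j % 2 = k % 2 then indic (j, D + 1 - j) p else 0

theorem primVec_mem (D k : ℕ) : primVec D k ∈ seqSpan (primSet D k) := by
  have h : primVec D k =
      ∑ j ∈ Finset.Icc 1 k, if j % 2 = k % 2 then indic (j, D + 1 - j) else 0 := by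
    funext p
    rw [Finset.sum_apply]
    refine Finset.sum_congr rfl fun j _ => ?_
    split_ifs <;> rfl
  rw [h]
  refine Submodule.sum_mem _ fun j hj => ?_
  split_ifs
  · exact Submodule.subset_span ⟨_, Finset.mem_image_of_mem _ hj, rfl⟩
  · exact zero_mem _

/-- Only the interval that starts at `q + 1` and the one that ends at `q`, which has `j = D + 1 -
q`, can contribute to the jump. -/
theorem primVec_add_succ {D k q : ℕ} (hk : k ≤ D / 2) (hq : q ≤ D) :
    primVec D k q + primVec D k (q + 1) =
      (if q < k then if (q + 1) % 2 = k % 2 then 1 else 0 else 0) +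
      (if D < q + k then if (D + 1 - q) % 2 = k % 2 then 1 else 0 else 0) := by
  have h : primVec D k q + primVec D k (q + 1) =
      (∑ j ∈ Finset.Icc 1 k, if j = q + 1 then if (q + 1) % 2 = k % 2 then 1 else 0 else 0) +
      ∑ j ∈ Finset.Icc 1 k, if j = D + 1 - q then if (D + 1 - q) % 2 = k % 2 then 1 else 0 else 0 := by
    rw [primVec, primVec, ← Finset.sum_add_distrib, ← Finset.sum_add_distrib]
    refine Finset.sum_congr rfl fun j hj => ?_
    have hj := Finset.mem_Icc.1 hj
    by_cases hp : j % 2 = k % 2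
    · rw [if_pos hp, if_pos hp, indic_add_succ (by dsimp only; omega)]
      dsimp only
      congr 1 <;> split_ifs <;> first | rfl | omega
    · rw [if_neg hp, if_neg hp]
      split_ifs <;> first | rfl | omega
  rw [h, Finset.sum_ite_eq', Finset.sum_ite_eq']
  simp only [Finset.mem_Icc]
  congr 1 <;> split_ifs <;> first | rfl | omega

/-- Taking every second interval makes the jumps compensate the alternating sign, so all outer steps
point the same way. -/
theorem stepSign_primVec_outer {D k q : ℕ} (hD : Even D) (hk : k ≤ D / 2) (hq : q ≤ D)
    (h : q < k ∨ D < q + k) : stepSign (primVec D k) q = (-1) ^ k := by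
  obtain ⟨d, rfl⟩ := hD
  rw [stepSign, primVec_add_succ hk hq]
  by_cases hp : q % 2 = k % 2
  · have h0 : ((if q < k then if (q + 1) % 2 = k % 2 then 1 else 0 else 0) +
      (if d + d < q + k then if (d + d + 1 - q) % 2 = k % 2 then 1 else 0 else 0) : ZMod 2) = 0 := by
      split_ifs <;> first | rfl | omega
    rw [h0]
    simp only [sgz, if_true, mul_one]
    rw [neg_one_pow_eq_pow_mod_two, hp, ← neg_one_pow_eq_pow_mod_two]
  · have h0 : ((if q < k then if (q + 1) % 2 = k % 2 then 1 else 0 else 0) +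
      (if d + d < q + k then if (d + d + 1 - q) % 2 = k % 2 then 1 else 0 else 0) : ZMod 2) = 1 := by
      split_ifs <;> first | rfl | omega
    rw [h0]
    have : sgz 1 = -1 := by decide
    rw [this, ← pow_succ, neg_one_pow_eq_pow_mod_two, show (q + 1) % 2 = k % 2 by omega,
      ← neg_one_pow_eq_pow_mod_two]

/-- The nested intervals have a common centre and no jump in the middle range. Symmetry makes the
balances antisymmetric, and constancy makes the middle steps alternate. -/
theorem seqSpan_primSet_symm {D k : ℕ} {w : ℕ → ZMod 2}
    (hw : w ∈ seqSpan (primSet D k)) :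
    (∀ p ≤ D + 1, w (D + 1 - p) = w p) ∧ ∀ p, k ≤ p → p + k ≤ D → w p = w (p + 1) := by
  induction hw using Submodule.span_induction with
  | mem x hx =>
    obtain ⟨I, hI, rfl⟩ := hx
    obtain ⟨j, hj, rfl⟩ := Finset.mem_image.1 hI
    have := Finset.mem_Icc.1 hj
    constructor
    · intro p hp
      simp only [indic]
      split_ifs <;> first | rfl | omega
    · intro p h1 h2
      simp only [indic]
      split_ifs <;> first | rfl | omega
  | zero => exact ⟨fun _ _ => rfl, fun _ _ _ => rfl⟩
  | add x y _ _ hx hy =>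
    refine ⟨fun p hp => ?_, fun p h1 h2 => ?_⟩
    · simp only [Pi.add_apply, hx.1 p hp, hy.1 p hp]
    · simp only [Pi.add_apply, hx.2 p h1 h2, hy.2 p h1 h2]
  | smul a x _ hx =>
    refine ⟨fun p hp => ?_, fun p h1 h2 => ?_⟩
    · simp only [Pi.smul_apply, hx.1 p hp]
    · simp only [Pi.smul_apply, hx.2 p h1 h2]

section prim

variable {D k : ℕ} {w : ℕ → ZMod 2}

theorem balance_symm_of_mem (hD : Even D) (hw : w ∈ seqSpan (primSet D k)) :
    ∀ p ≤ D + 1, balance D w (D + 1 - p) = - balance D w p := by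
  have hs := (seqSpan_primSet_symm hw).1
  intro p
  induction p with
  | zero => intro _; rw [Nat.sub_zero, balance_last, balance_zero, neg_neg]
  | succ p ih =>
    intro hp
    have h1 := ih (by omega)
    have h2 : D + 1 - p = (D + 1 - (p + 1)) + 1 := by omega
    rw [h2, balance_succ] at h1
    have h3 : stepSign w (D + 1 - (p + 1)) = stepSign w p := by
      unfold stepSign
      rw [← h2, hs p (by omega), hs (p + 1) hp, add_comm (w (p + 1))]
      congr 1
      rw [neg_one_pow_eq_pow_mod_two, neg_one_pow_eq_pow_mod_two (n := p)]
      obtain ⟨d, rfl⟩ := hD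
      congr 1
      omega
    rw [balance_succ]
    linarith

theorem balance_middle_of_mem (hD : Even D) (hk : k ≤ D / 2) (hw : w ∈ seqSpan (primSet D k)) :
    ∀ p, k ≤ p → p + k ≤ D + 1 → balance D w p = - (-1) ^ p := by
  have hstep : ∀ p, k ≤ p → p + k ≤ D → stepSign w p = (-1) ^ p := by
    intro p h1 h2
    rw [stepSign, (seqSpan_primSet_symm hw).2 p h1 h2, zmod2_add_self]
    simp [sgz]
  have hconst : ∀ p, k ≤ p → p + k ≤ D + 1 →
      balance D w p + (-1) ^ p = balance D w k + (-1) ^ k := by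
    intro p hp
    induction p, hp using Nat.le_induction with
    | base => intro _; rfl
    | succ p hp ih =>
      intro h
      rw [← ih (by omega), balance_succ, hstep p hp (by omega), pow_succ]
      ring
  obtain ⟨d, rfl⟩ := hD
  -- The two central balances are opposite and differ by `2 (-1)^d`, which fixes both.
  have h1 := balance_symm_of_mem ⟨d, rfl⟩ hw d (by omega)
  rw [show d + d + 1 - d = d + 1 by omega, balance_succ, hstep d (by omega) (by omega)] at h1
  intro p h2 h3
  have h4 := hconst p h2 h3
  have h5 := hconst d (by omega) (by omega)
  linarith

theorem abs_balance_le_of_mem (hD : Even D) (hk : k ≤ D / 2) (hw : w ∈ seqSpan (primSet D k)) :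
    ∀ p ≤ k, |balance D w p| ≤ 2 * (k - p) + 1 := by
  intro p hp
  induction hp using Nat.decreasingInduction with
  | self =>
    rw [balance_middle_of_mem hD hk hw k le_rfl (by omega)]
    simp
  | of_succ p hp ih =>
    rw [balance_succ] at ih
    push_cast at ih
    rw [abs_le] at ih ⊢
    rcases stepSign_cases w p with h | h <;> rw [h] at ih <;> constructor <;> linarith [ih.1, ih.2]

theorem balance_primVec (hD : Even D) (hk : k ≤ D / 2) :
    ∀ p ≤ k, balance D (primVec D k) p = - (-1) ^ k * (2 * (k - p) + 1) := by
  intro p hp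
  induction hp using Nat.decreasingInduction with
  | self =>
    rw [balance_middle_of_mem hD hk (primVec_mem D k) k le_rfl (by omega)]
    ring
  | of_succ p hp ih =>
    rw [balance_succ, stepSign_primVec_outer hD hk (by omega) (Or.inl hp)] at ih
    push_cast at ih
    linarith

theorem abs_balance_primVec (hD : Even D) (hk : k ≤ D / 2) {p : ℕ} (hp : p ≤ k) :
    |balance D (primVec D k) p| = 2 * (k - p) + 1 := by
  rw [balance_primVec hD hk p hp, abs_mul, abs_neg, abs_pow, abs_neg, abs_one, one_pow, one_mul,
    abs_of_nonneg]
  have : (p : ℤ) ≤ k := by exact_mod_cast hp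
  linarith

theorem abs_balance_le_primVec (hD : Even D) (hk : k ≤ D / 2) (hw : w ∈ seqSpan (primSet D k))
    {p : ℕ} (hp : p ≤ D + 1) : |balance D w p| ≤ |balance D (primVec D k) p| := by
  rcases le_total p k with h1 | h1
  · rw [abs_balance_primVec hD hk h1]
    exact abs_balance_le_of_mem hD hk hw p h1
  · rcases le_total (p + k) (D + 1) with h2 | h2
    · rw [balance_middle_of_mem hD hk hw p h1 h2,
        balance_middle_of_mem hD hk (primVec_mem D k) p h1 h2]
    · have h3 : D + 1 - p ≤ k := by omega
      have h4 := balance_symm_of_mem hD hw p hp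
      have h5 := balance_symm_of_mem hD (primVec_mem D k) p hp
      rw [← abs_neg, ← h4, ← abs_neg (balance D (primVec D k) p), ← h5,
        abs_balance_primVec hD hk h3]
      exact abs_balance_le_of_mem hD hk hw _ h3

/-- The balances of `primVec D k` have no outward peak. -/
theorem primVec_no_peak (hD : Even D) (hk : k ≤ D / 2) {p : ℕ} (hp : p + 1 ≤ D)
    (h1 : |balance D (primVec D k) p| < |balance D (primVec D k) (p + 1)|) :
    |balance D (primVec D k) (p + 1)| < |balance D (primVec D k) (p + 2)| := by
  have hmid : ∀ q, k ≤ q → q + k ≤ D + 1 → |balance D (primVec D k) q| = 1 := by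
    intro q a b
    rw [balance_middle_of_mem hD hk (primVec_mem D k) q a b]
    simp
  have hright : ∀ q ≤ D + 1, D + 1 ≤ q + k →
      |balance D (primVec D k) q| = 2 * (k - (D + 1 - q : ℕ)) + 1 := by
    intro q a b
    rw [← abs_neg, ← balance_symm_of_mem hD (primVec_mem D k) q a,
      abs_balance_primVec hD hk (by omega)]
  rcases Nat.lt_or_ge p k with h2 | h2
  · rw [abs_balance_primVec hD hk h2.le, abs_balance_primVec hD hk (Nat.succ_le_of_lt h2)] at h1
    push_cast at h1
    omega
  · rcases Nat.lt_or_ge (D + 1) (p + 1 + k) with h3 | h3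
    · rw [hright _ (by omega) (by omega), hright _ (by omega) (by omega)]
      omega
    · rw [hmid p h2 (by omega), hmid (p + 1) (by omega) h3] at h1
      omega

end prim

/-! ## The leading vector of an element of `𝕊_D` -/

/-- `IsLeading D B x` says that `B ∈ 𝕊_D` and that `x` is the vector of the subspace attached to `B`
whose balances have the largest absolute values. -/
inductive IsLeading : ℕ → Finset (ℕ × ℕ) → (ℕ → ZMod 2) → Prop
  | prim (D k : ℕ) (hD : Even D) (hk : k ≤ D / 2) : IsLeading D (primSet D k) (primVec D k)
  | step (D i : ℕ) (B : Finset (ℕ × ℕ)) (x : ℕ → ZMod 2) (c : ZMod 2) (hi : i ≤ D + 1)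
      (hB : IsLeading D B x)
      (hc : |balance D x i + 2 * ((-1) ^ i * sgz c)| = |balance D x i| + 2) :
      IsLeading (D + 2) (tMap (i + 1) B) (ins (i + 1) c x)

theorem IsLeading.even {D : ℕ} {B : Finset (ℕ × ℕ)} {x : ℕ → ZMod 2} (h : IsLeading D B x) :
    Even D := by
  induction h with
  | prim D k hD hk => exact hD
  | step D i B x c hi _ hc ih => exact ih.add even_two

theorem IsLeading.sd {D : ℕ} {B : Finset (ℕ × ℕ)} {x : ℕ → ZMod 2} (h : IsLeading D B x) :
    SD D B := by
  induction h with
  | prim D k hD hk => exact SD.prim D k hD hk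
  | step D i B x c hi _ hc ih => exact ih.step D (i + 1) B (by omega) (by omega)

theorem IsLeading.mem {D : ℕ} {B : Finset (ℕ × ℕ)} {x : ℕ → ZMod 2} (h : IsLeading D B x) :
    x ∈ seqSpan B := by
  induction h with
  | prim D k hD hk => exact primVec_mem D k
  | step D i B x c hi hB hc ih => exact ins_mem_seqSpan_tMap hB.sd.separated ih c

theorem IsLeading.suppIn {D : ℕ} {B : Finset (ℕ × ℕ)} {x : ℕ → ZMod 2} (h : IsLeading D B x) :
    SuppIn D x := h.sd.separated.suppIn h.mem

/-- Away from an inserted peak the balances are the old ones. At the peak no vector can exceed its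
old absolute value by more than `2`, and the leading vector attains this gain. -/
theorem IsLeading.abs_balance_le {D : ℕ} {B : Finset (ℕ × ℕ)} {x : ℕ → ZMod 2}
    (h : IsLeading D B x) {w : ℕ → ZMod 2} (hw : w ∈ seqSpan B) {p : ℕ} (hp : p ≤ D + 1) :
    |balance D w p| ≤ |balance D x p| := by
  induction h generalizing w p with
  | prim D k hD hk => exact abs_balance_le_primVec hD hk hw hp
  | step D i B x c hi hB hc ih =>
    obtain ⟨y, hy, d, rfl⟩ := exists_of_mem_seqSpan_tMap hB.sd.separated hw
    rcases Nat.lt_trichotomy p (i + 1) with h1 | rfl | h1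
    · rw [balance_ins_le hi _ _ (by omega), balance_ins_le hi _ _ (by omega)]
      exact ih hy (by omega)
    · rw [balance_ins_peak hi, balance_ins_peak hi, hc]
      have h2 := ih hy hi
      have h3 : |2 * ((-1) ^ i * sgz d)| = 2 := by
        rcases neg_one_pow_cases i with e | e <;> rcases sgz_cases d with e' | e' <;>
          simp [e, e']
      linarith [abs_add_le (balance D y i) (2 * ((-1) ^ i * sgz d))]
    · obtain ⟨q, rfl⟩ : ∃ q, p = q + 2 := ⟨p - 2, by omega⟩
      rw [balance_ins_gt hi _ _ (by omega), balance_ins_gt hi _ _ (by omega)]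
      exact ih hy (by omega)

theorem exists_outward_sign (a : ℤ) (i : ℕ) :
    ∃ c, |a + 2 * ((-1) ^ i * sgz c)| = |a| + 2 := by
  have h1 : sgz 0 = 1 := by decide
  have h2 : sgz 1 = -1 := by decide
  rcases neg_one_pow_cases i with e | e <;> rcases le_total 0 a with ha | ha
  · exact ⟨0, by rw [e, h1, abs_of_nonneg ha, abs_of_nonneg (by linarith)]; ring⟩
  · exact ⟨1, by rw [e, h2, abs_of_nonpos ha, abs_of_nonpos (by linarith)]; ring⟩
  · exact ⟨1, by rw [e, h2, abs_of_nonneg ha, abs_of_nonneg (by linarith)]; ring⟩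
  · exact ⟨0, by rw [e, h1, abs_of_nonpos ha, abs_of_nonpos (by linarith)]; ring⟩

theorem SD.exists_isLeading {D : ℕ} {B : Finset (ℕ × ℕ)} (h : SD D B) : ∃ x, IsLeading D B x := by
  induction h with
  | prim D k hD hk => exact ⟨_, IsLeading.prim D k hD hk⟩
  | step D i B h1 h2 _ ih =>
    obtain ⟨x, hx⟩ := ih
    obtain ⟨j, rfl⟩ : ∃ j, i = j + 1 := ⟨i - 1, by omega⟩
    obtain ⟨c, hc⟩ := exists_outward_sign (balance D x j) j
    exact ⟨_, IsLeading.step D j B x c (by omega) hx hc⟩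

/-- Insertions never touch the balance at `0`, and `primVec D k` has absolute balance `2k + 1`
there. So the value `1` records that the construction began with `k = 0`. -/
theorem SD₀.exists_isLeading {D : ℕ} {B : Finset (ℕ × ℕ)} (h : SD₀ D B) :
    ∃ x, IsLeading D B x ∧ |balance D x 0| = 1 := by
  induction h with
  | empty D hD =>
    have h := IsLeading.prim D 0 hD (Nat.zero_le _)
    refine ⟨_, h, ?_⟩
    simp [abs_balance_primVec hD (Nat.zero_le _) le_rfl]
  | step D i B h1 h2 _ ih =>
    obtain ⟨x, hx, hx0⟩ := ih
    obtain ⟨j, rfl⟩ : ∃ j, i = j + 1 := ⟨i - 1, by omega⟩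
    obtain ⟨c, hc⟩ := exists_outward_sign (balance D x j) j
    refine ⟨_, IsLeading.step D j B x c (by omega) hx hc, ?_⟩
    rw [balance_ins_le (by omega) _ _ (Nat.zero_le _), hx0]

theorem IsLeading.sd₀ {D : ℕ} {B : Finset (ℕ × ℕ)} {x : ℕ → ZMod 2} (h : IsLeading D B x)
    (h0 : |balance D x 0| = 1) : SD₀ D B := by
  induction h with
  | prim D k hD hk =>
    rw [abs_balance_primVec hD hk (Nat.zero_le k)] at h0
    have : k = 0 := by push_cast at h0; omega
    subst this
    simpa [primSet] using SD₀.empty D hD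
  | step D i B x c hi hB hc ih =>
    rw [balance_ins_le (by omega) _ _ (Nat.zero_le _)] at h0
    exact (ih h0).step D (i + 1) B (by omega) (by omega)

/-! ## Existence and uniqueness of the set with a given leading vector -/

theorem int_abs_cases (a : ℤ) : (0 ≤ a ∧ |a| = a) ∨ (a < 0 ∧ |a| = -a) := by
  rcases le_or_gt 0 a with h | h
  · exact Or.inl ⟨h, abs_of_nonneg h⟩
  · exact Or.inr ⟨h, abs_of_neg h⟩

theorem abs_balance_succ_cases {D : ℕ} (hD : Even D) (x : ℕ → ZMod 2) (p : ℕ) :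
    |balance D x (p + 1)| = |balance D x p| + 2 ∨ |balance D x p| = |balance D x (p + 1)| + 2 ∨
      (|balance D x p| = 1 ∧ |balance D x (p + 1)| = 1) := by
  obtain ⟨m, hm⟩ := balance_odd hD x p
  have h1 := int_abs_cases (balance D x p)
  have h2 := int_abs_cases (balance D x (p + 1))
  have h3 := balance_succ D x p
  rcases stepSign_cases x p with h | h <;> rw [h] at h3 <;> omega

theorem one_le_abs_balance {D : ℕ} (hD : Even D) (x : ℕ → ZMod 2) (p : ℕ) :
    1 ≤ |balance D x p| := by
  obtain ⟨m, hm⟩ := balance_odd hD x p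
  have := int_abs_cases (balance D x p)
  omega

/-- The first and last balances are opposite, so the sign changes somewhere, and an odd sequence
with increments `±2` crosses `0` only between `1` and `-1`. -/
theorem exists_abs_balance_eq_one {D : ℕ} (hD : Even D) (x : ℕ → ZMod 2) :
    ∃ m ≤ D, |balance D x m| = 1 ∧ |balance D x (m + 1)| = 1 := by
  have hex : ∃ p, ¬ (0 < balance D x p ↔ 0 < balance D x 0) := by
    refine ⟨D + 1, ?_⟩
    rw [balance_last, balance_zero]
    have h := one_le_abs_balance hD x 0
    rw [balance_zero] at h
    have := int_abs_cases (-walk x (D + 1))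
    omega
  classical
  have h1 := Nat.find_spec hex
  have h0 : Nat.find hex ≠ 0 := by
    intro h
    rw [h] at h1
    exact h1 Iff.rfl
  obtain ⟨m, hm⟩ := Nat.exists_eq_succ_of_ne_zero h0
  have h2 := Nat.find_min hex (m := m) (by omega)
  have h3 : Nat.find hex ≤ D + 1 := by
    refine Nat.find_min' hex ?_
    rw [balance_last, balance_zero]
    have h := one_le_abs_balance hD x 0
    rw [balance_zero] at h
    have := int_abs_cases (-walk x (D + 1))
    omega
  rw [hm, Nat.succ_eq_add_one] at h1
  refine ⟨m, by omega, ?_⟩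
  have h4 := one_le_abs_balance hD x m
  have h5 := one_le_abs_balance hD x (m + 1)
  have h6 := balance_succ D x m
  have h7 := int_abs_cases (balance D x m)
  have h8 := int_abs_cases (balance D x (m + 1))
  rcases stepSign_cases x m with h | h <;> rw [h] at h6 <;> omega

/-- A sequence whose balances have no outward peak is the leading vector of a primitive set. -/
theorem eq_primVec_of_no_peak {D : ℕ} (hD : Even D) {x : ℕ → ZMod 2} (hx : SuppIn D x)
    (h : ∀ p, p + 1 ≤ D → |balance D x p| < |balance D x (p + 1)| →
      |balance D x (p + 1)| ≤ |balance D x (p + 2)|) :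
    ∃ k ≤ D / 2, x = primVec D k := by
  obtain ⟨m, hmD, hm, hm1⟩ := exists_abs_balance_eq_one hD x
  have hcase := abs_balance_succ_cases hD x
  have hone := one_le_abs_balance hD x
  -- Without outward peaks a rise is never followed by a fall, and equal neighbours are both `1`,
  -- the minimum. So the absolute balances form a valley with bottom at `m`, `m + 1`.
  have hup : ∀ p, m ≤ p → p ≤ D → |balance D x p| ≤ |balance D x (p + 1)| := by
    intro p hp
    induction p, hp using Nat.le_induction with
    | base => intro _; omega
    | succ p hp ih =>
      intro hpD
      have := ih (by omega)
      have := h p (by omega)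
      have := hcase p
      have := hone (p + 2)
      have : p + 1 + 1 = p + 2 := rfl
      rw [this]
      omega
  have hdown : ∀ p ≤ m, |balance D x (p + 1)| ≤ |balance D x p| := by
    intro p hp
    induction hp using Nat.decreasingInduction with
    | self => omega
    | of_succ p hp ih =>
      by_contra hlt
      have h1 := h p (by omega) (by omega)
      have h2 := hcase p
      have h3 := hcase (p + 1)
      have h4 := hone p
      have : p + 1 + 1 = p + 2 := rfl
      rw [this] at ih h3
      omega
  obtain ⟨k, hk⟩ : ∃ k : ℕ, |balance D x 0| = 2 * k + 1 := by
    obtain ⟨a, ha⟩ := balance_odd hD x 0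
    rcases int_abs_cases (balance D x 0) with h0 | h0
    · exact ⟨a.toNat, by omega⟩
    · exact ⟨(-a - 1).toNat, by omega⟩
  have hlast : |balance D x (D + 1)| = 2 * k + 1 := by
    rw [← hk, balance_last, balance_zero, abs_neg]
  have hleft : ∀ p ≤ m, |balance D x p| = max 1 (2 * (k : ℤ) + 1 - 2 * p) := by
    intro p
    induction p with
    | zero => intro _; rw [hk]; push_cast; omega
    | succ p ih =>
      intro hp
      have h1 := ih (by omega)
      have h2 := hdown p (by omega)
      have h3 := hcase p
      have h4 := hone (p + 1)
      push_cast
      omega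
  have hright : ∀ q, q + m ≤ D → |balance D x (D + 1 - q)| = max 1 (2 * (k : ℤ) + 1 - 2 * q) := by
    intro q
    induction q with
    | zero => intro _; rw [Nat.sub_zero, hlast]; push_cast; omega
    | succ q ih =>
      intro hq
      have h1 := ih (by omega)
      have h2 := hup (D + 1 - (q + 1)) (by omega) (by omega)
      have h3 := hcase (D + 1 - (q + 1))
      have h4 := hone (D + 1 - (q + 1))
      rw [show D + 1 - (q + 1) + 1 = D + 1 - q by omega] at h2 h3
      rw [Nat.cast_succ]
      omega
  -- The value `1` at `m` and at `m + 1` forces `k ≤ m` and `k ≤ D - m`, hence `k ≤ D / 2`.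
  have hkm := hleft m le_rfl
  have hkD := hright (D - m) (by omega)
  rw [show D + 1 - (D - m) = m + 1 by omega] at hkD
  have hk2 : k ≤ D / 2 := by omega
  refine ⟨k, hk2, ?_⟩
  have hmem := primVec_mem D k
  refine eq_of_abs_balance_eq hD hx ((separated_primSet hk2).suppIn hmem) fun p hp => ?_
  rcases Nat.lt_or_ge m p with h1 | h1
  · have h2 := hright (D + 1 - p) (by omega)
    rw [show D + 1 - (D + 1 - p) = p by omega] at h2
    rcases Nat.lt_or_ge (D + 1) (p + k) with h3 | h3
    · have h4 := balance_symm_of_mem hD hmem p hp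
      rw [h2, ← abs_neg, ← h4, abs_balance_primVec hD hk2 (by omega)]
      omega
    · rw [h2, balance_middle_of_mem hD hk2 hmem p (by omega) h3]
      simp only [abs_neg, abs_pow, abs_one, one_pow]
      omega
  · rw [hleft p h1]
    rcases Nat.lt_or_ge p k with h3 | h3
    · rw [abs_balance_primVec hD hk2 h3.le]
      omega
    · rw [balance_middle_of_mem hD hk2 hmem p h3 (by omega)]
      simp only [abs_neg, abs_pow, abs_one, one_pow]
      omega

theorem eq_of_stepSign_eq_neg {x : ℕ → ZMod 2} {p : ℕ} (h : stepSign x (p + 1) = - stepSign x p) :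
    x p = x (p + 2) := by
  unfold stepSign at h
  rw [pow_succ] at h
  have h1 : sgz (x (p + 1) + x (p + 1 + 1)) = sgz (x p + x (p + 1)) := by
    apply mul_left_cancel₀ (a := (-1 : ℤ) ^ p) (by positivity)
    linarith
  have h2 := sgz_injective h1
  rw [add_comm] at h2
  exact (add_right_cancel h2).symm

/-- At an outward peak the two steps are opposite, so the sequence is an insertion and induction
applies to the shorter one. -/
theorem exists_isLeading {D : ℕ} (hD : Even D) {x : ℕ → ZMod 2} (hx : SuppIn D x) :
    ∃ B, IsLeading D B x := by
  induction D using Nat.strong_induction_on generalizing x with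
  | _ D ih =>
  by_cases hpeak : ∃ p, p + 1 ≤ D ∧ |balance D x p| < |balance D x (p + 1)| ∧
      |balance D x (p + 2)| < |balance D x (p + 1)|
  · obtain ⟨p, hp, h1, h2⟩ := hpeak
    obtain ⟨E, rfl⟩ : ∃ E, D = E + 2 := ⟨D - 2, by obtain ⟨d, rfl⟩ := hD; omega⟩
    have hE : Even E := by simpa [Nat.even_add] using hD
    have h3 : stepSign x (p + 1) = - stepSign x p := by
      have e1 := balance_succ (E + 2) x p
      have e2 := balance_succ (E + 2) x (p + 1)
      rw [show p + 1 + 1 = p + 2 from rfl] at e2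
      have a0 := int_abs_cases (balance (E + 2) x p)
      have a1 := int_abs_cases (balance (E + 2) x (p + 1))
      have a2 := int_abs_cases (balance (E + 2) x (p + 2))
      rcases stepSign_cases x p with s | s <;> rcases stepSign_cases x (p + 1) with s' | s' <;>
        rw [s] at e1 ⊢ <;> rw [s'] at e2 ⊢ <;> omega
    obtain ⟨y, c, hy, rfl⟩ := exists_eq_ins (i := p + 1) hx (by omega) (by omega)
      (eq_of_stepSign_eq_neg h3)
    obtain ⟨B, hB⟩ := ih E (by omega) hE hy
    refine ⟨_, IsLeading.step E p B y c (by omega) hB ?_⟩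
    have h4 := abs_balance_succ_cases hD (ins (p + 1) c y) p
    rw [← balance_ins_peak (by omega), ← balance_ins_le (p := p) (by omega) c y le_rfl]
    omega
  · obtain ⟨k, hk, rfl⟩ := eq_primVec_of_no_peak hD hx fun p hp h1 => by
      by_contra h2
      exact hpeak ⟨p, hp, h1, not_le.1 h2⟩
    exact ⟨_, IsLeading.prim D k hD hk⟩

/-! ### Confluence of the removal of outward peaks -/

section commute

variable {D i j : ℕ} {c d : ZMod 2} {u v : ℕ → ZMod 2}

theorem peak_lt (hi : i ≤ D + 1) (hc : |balance D u i + 2 * ((-1) ^ i * sgz c)| = |balance D u i| + 2) :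
    |balance (D + 2) (ins (i + 1) c u) (i + 1)| = |balance (D + 2) (ins (i + 1) c u) i| + 2 ∧
    |balance (D + 2) (ins (i + 1) c u) (i + 2)| = |balance (D + 2) (ins (i + 1) c u) i| := by
  rw [balance_ins_peak hi, balance_ins_le hi c u le_rfl, hc, balance_ins_gt hi c u le_rfl]
  exact ⟨rfl, rfl⟩

/-- A diamond argument: removing both peaks leaves a sequence `y`, the leading vector of some `C`.
By induction `B` and `B'` each arise from `C` by inserting one peak, and `tMap_comm` compares the
results. -/
theorem tMap_eq_tMap_of_lt
    (ih : ∀ B B' x, IsLeading D B x → IsLeading D B' x → B = B') {B B' : Finset (ℕ × ℕ)}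
    (hi : i ≤ D + 1) (hj : j ≤ D + 1) (hB : IsLeading D B u) (hB' : IsLeading D B' v)
    (hc : |balance D u i + 2 * ((-1) ^ i * sgz c)| = |balance D u i| + 2)
    (hd : |balance D v j + 2 * ((-1) ^ j * sgz d)| = |balance D v j| + 2)
    (h : ins (i + 1) c u = ins (j + 1) d v) (hij : i < j) :
    tMap (i + 1) B = tMap (j + 1) B' := by
  have p1 := peak_lt hi hc
  have p2 := peak_lt hj hd
  rw [← h] at p2
  -- Adjacent places cannot both be outward peaks, since each would be higher than the other.
  have hne : j ≠ i + 1 := by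
    rintro rfl
    rw [show i + 1 + 1 = i + 2 from rfl] at p2
    omega
  obtain ⟨l, rfl⟩ : ∃ l, j = l + 2 := ⟨j - 2, by omega⟩
  have hD := hB.even
  obtain ⟨E, rfl⟩ : ∃ E, D = E + 2 := ⟨D - 2, by obtain ⟨m, rfl⟩ := hD; omega⟩
  have hE : Even E := by simpa [Nat.even_add] using hD
  have hu : u l = u (l + 2) := by
    have e1 : ins (i + 1) c u (l + 2) = u l := by
      simp [ins, show ¬ l + 2 < i + 1 by omega, show ¬ l + 1 = i by omega]
    have e2 : ins (i + 1) c u (l + 4) = u (l + 2) := by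
      simp [ins, show ¬ l + 4 < i + 1 by omega, show ¬ l + 3 = i by omega]
    have e3 : ins (l + 2 + 1) d v (l + 2) = v (l + 2) := by simp [ins]
    have e4 : ins (l + 2 + 1) d v (l + 4) = v (l + 2) := by simp [ins]
    rw [← e1, ← e2, h, e3, e4]
  obtain ⟨y, a, hy, rfl⟩ := exists_eq_ins (i := l + 1) hB.suppIn (by omega) (by omega) hu
  obtain ⟨C, hC⟩ := exists_isLeading hE hy
  have b1 : balance (E + 2 + 2) (ins (i + 1) c (ins (l + 1) a y)) (l + 2 + 1) =
      balance E y l + 2 * ((-1) ^ l * sgz a) := by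
    rw [show l + 2 + 1 = l + 1 + 2 by ring, balance_ins_gt hi _ _ (by omega),
      balance_ins_peak (by omega)]
  have b2 : balance (E + 2 + 2) (ins (i + 1) c (ins (l + 1) a y)) (l + 2) = balance E y l := by
    rw [balance_ins_gt hi _ _ (by omega), balance_ins_le (by omega) _ _ le_rfl]
  rw [b1, b2] at p2
  have hv : v = ins (i + 1) c y := by
    rw [← ins_comm (by omega) (by omega)] at h
    exact (ins_injective h).symm
  rw [balance_ins_le (by omega) _ _ (by omega)] at hc
  have r1 := ih _ _ _ hB (IsLeading.step E l C y a (by omega) hC p2.1)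
  have r2 := ih _ _ _ hB' (hv ▸ IsLeading.step E i C y c (by omega) hC hc)
  rw [r1, r2, show l + 2 + 1 = l + 1 + 2 by ring, tMap_comm (by omega)]

end commute

theorem IsLeading.unique {D : ℕ} {B B' : Finset (ℕ × ℕ)} {x : ℕ → ZMod 2} (h : IsLeading D B x)
    (h' : IsLeading D B' x) : B = B' := by
  induction D using Nat.strong_induction_on generalizing x B B' with
  | _ D ih =>
  have inv : ∀ {B}, IsLeading D B x →
      (∃ k ≤ D / 2, B = primSet D k ∧ x = primVec D k) ∨
      ∃ E i C y c, D = E + 2 ∧ i ≤ E + 1 ∧ IsLeading E C y ∧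
        |balance E y i + 2 * ((-1) ^ i * sgz c)| = |balance E y i| + 2 ∧
        B = tMap (i + 1) C ∧ x = ins (i + 1) c y := by
    intro B h
    cases h with
    | prim _ k hD hk => exact Or.inl ⟨k, hk, rfl, rfl⟩
    | step E i C y c hi hC hc => exact Or.inr ⟨E, i, C, y, c, rfl, hi, hC, hc, rfl, rfl⟩
  have hD := h.even
  have mixed : ∀ {k E i y c}, k ≤ D / 2 → x = primVec D k → D = E + 2 → i ≤ E + 1 →
        |balance E y i + 2 * ((-1) ^ i * sgz c)| = |balance E y i| + 2 →
        x = ins (i + 1) c y → False := by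
    intro k E i y c hk hx hDE hi hc hx'
    subst hDE
    have p1 := peak_lt hi hc
    rw [← hx', hx] at p1
    have := primVec_no_peak hD hk (p := i) (by omega) (by omega)
    omega
  rcases inv h with ⟨k, hk, rfl, hx⟩ | ⟨E, i, C, y, c, hDE, hi, hC, hc, rfl, hx⟩ <;>
    rcases inv h' with ⟨l, hl, rfl, hx'⟩ | ⟨E', j, C', y', c', hDE', hj, hC', hc', rfl, hx'⟩
  · have h1 := abs_balance_primVec hD hk (Nat.zero_le k)
    have h2 := abs_balance_primVec hD hl (Nat.zero_le l)
    rw [← hx] at h1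
    rw [← hx', h1] at h2
    have : k = l := by omega
    rw [this]
  · exact (mixed hk hx hDE' hj hc' hx').elim
  · exact (mixed hl hx' hDE hi hc hx).elim
  · obtain rfl : E = E' := by omega
    have ih' : ∀ B B' x, IsLeading E B x → IsLeading E B' x → B = B' :=
      fun B B' x h1 h2 => ih E (by omega) h1 h2
    rw [hx] at hx'
    rcases Nat.lt_trichotomy i j with hij | rfl | hij
    · exact tMap_eq_tMap_of_lt ih' hi hj hC hC' hc hc' hx' hij
    · rw [ins_injective hx'] at hC
      rw [ih' _ _ _ hC hC']
    · exact (tMap_eq_tMap_of_lt ih' hj hi hC' hC hc' hc hx'.symm hij).symm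

open Classical

/-! ## Vectors as sequences -/

/-- The coordinates of `x`, extended by `0`. -/
def ext (D : ℕ) : V D →ₗ[ZMod 2] (ℕ → ZMod 2) where
  toFun x p := ∑ i : Fin D, if p = i + 1 then x i else 0
  map_add' x y := by
    funext p
    simp only [Pi.add_apply, ← Finset.sum_add_distrib]
    exact Finset.sum_congr rfl fun i _ => by split_ifs <;> simp
  map_smul' a x := by
    funext p
    simp only [Pi.smul_apply, smul_eq_mul, Finset.mul_sum, RingHom.id_apply]
    exact Finset.sum_congr rfl fun i _ => by split_ifs <;> simp

theorem ext_apply {D : ℕ} (x : V D) (p : ℕ) :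
    ext D x p = ∑ i : Fin D, if p = i + 1 then x i else 0 := rfl

theorem ext_succ {D : ℕ} (x : V D) (i : Fin D) : ext D x (i + 1) = x i := by
  rw [ext_apply, Finset.sum_eq_single i]
  · simp
  · intro j _ hj
    rw [if_neg]
    intro h
    exact hj (Fin.ext (by omega))
  · simp

theorem ext_suppIn {D : ℕ} (x : V D) : SuppIn D (ext D x) := by
  refine ⟨?_, fun p hp => ?_⟩ <;> rw [ext_apply] <;>
    exact Finset.sum_eq_zero fun i _ => if_neg (by omega)

theorem ext_injective (D : ℕ) : Function.Injective (ext D) := by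
  intro x y h
  funext i
  rw [← ext_succ x, ← ext_succ y, h]

theorem exists_ext_eq {D : ℕ} {y : ℕ → ZMod 2} (hy : SuppIn D y) : ∃ x, ext D x = y := by
  refine ⟨fun i => y (i + 1), ?_⟩
  funext p
  by_cases h : 1 ≤ p ∧ p ≤ D
  · have := ext_succ (fun i : Fin D => y (i + 1)) ⟨p - 1, by omega⟩
    simpa only [show p - 1 + 1 = p by omega] using this
  · rcases Nat.eq_zero_or_pos p with rfl | hp
    · rw [hy.1, (ext_suppIn _).1]
    · rw [hy.2 p (by omega), (ext_suppIn _).2 p (by omega)]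

theorem ext_eInt {D : ℕ} {I : ℕ × ℕ} (h1 : 1 ≤ I.1) (h2 : I.2 ≤ D) :
    ext D (eInt D I) = indic I := by
  obtain ⟨x, hx⟩ := exists_ext_eq (indic_suppIn h1 h2)
  rw [← hx]
  congr 1
  funext i
  rw [← ext_succ x, hx]
  rfl

theorem ext_mem_seqSpan {D : ℕ} {B : Finset (ℕ × ℕ)} (hB : Separated D B) {x : V D} :
    ext D x ∈ seqSpan B ↔ x ∈ bracket D B := by
  have h : seqSpan B = (bracket D B).map (ext D) := by
    rw [bracket, Submodule.map_span, seqSpan, Set.image_image]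
    congr 1
    refine Set.image_congr fun I hI => ?_
    exact (ext_eInt (hB.bounds I hI).1 (hB.bounds I hI).2.2).symm
  rw [h]
  exact ⟨fun ⟨y, hy, e⟩ => ext_injective D e ▸ hy, fun hx => ⟨x, hx, rfl⟩⟩

/-! ## The symplectic form -/

theorem form_eq_sum {D : ℕ} (x y : V D) : form D x y =
    ∑ i : Fin D, x i * (ext D y i + ext D y (i + 2)) := by
  rw [form, Matrix.toBilin'_apply]
  refine Finset.sum_congr rfl fun i _ => ?_
  rw [ext_apply, ext_apply, ← Finset.sum_add_distrib, Finset.mul_sum]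
  refine Finset.sum_congr rfl fun j _ => ?_
  simp only [Matrix.of_apply]
  split_ifs <;> first | omega | simp

/-- In the coordinates given by the jumps the form is the standard dot product, which makes
symmetry, alternation and the orthogonality of separated intervals visible. -/
theorem form_eq_sum_range {D : ℕ} (x y : V D) : form D x y =
    ∑ q ∈ Finset.range (D + 1),
      (ext D x q + ext D x (q + 1)) * (ext D y q + ext D y (q + 1)) := by
  have h1 : form D x y =
      ∑ q ∈ Finset.range D, ext D x (q + 1) * (ext D y q + ext D y (q + 2)) := by
    rw [form_eq_sum, Finset.sum_range]
    exact Finset.sum_congr rfl fun i _ => by rw [ext_succ]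
  have hx0 := (ext_suppIn x).1
  have hy0 := (ext_suppIn y).1
  have hx1 := (ext_suppIn x).2 (D + 1) (by omega)
  have hy1 := (ext_suppIn y).2 (D + 1) (by omega)
  have a1 : ∑ q ∈ Finset.range (D + 1), ext D x q * ext D y q =
      ∑ q ∈ Finset.range D, ext D x (q + 1) * ext D y (q + 1) := by
    rw [Finset.sum_range_succ', hx0]; simp
  have a2 : ∑ q ∈ Finset.range (D + 1), ext D x (q + 1) * ext D y (q + 1) =
      ∑ q ∈ Finset.range D, ext D x (q + 1) * ext D y (q + 1) := by
    rw [Finset.sum_range_succ, hx1]; simp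
  have a3 : ∑ q ∈ Finset.range (D + 1), ext D x q * ext D y (q + 1) =
      ∑ q ∈ Finset.range D, ext D x (q + 1) * ext D y (q + 2) := by
    rw [Finset.sum_range_succ', hx0]; simp
  have a4 : ∑ q ∈ Finset.range (D + 1), ext D x (q + 1) * ext D y q =
      ∑ q ∈ Finset.range D, ext D x (q + 1) * ext D y q := by
    rw [Finset.sum_range_succ, hx1]; simp
  have h2 : ∑ q ∈ Finset.range (D + 1),
      (ext D x q + ext D x (q + 1)) * (ext D y q + ext D y (q + 1)) =
      (∑ q ∈ Finset.range (D + 1), ext D x q * ext D y q +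
        ∑ q ∈ Finset.range (D + 1), ext D x (q + 1) * ext D y (q + 1)) +
      (∑ q ∈ Finset.range (D + 1), ext D x (q + 1) * ext D y q +
        ∑ q ∈ Finset.range (D + 1), ext D x q * ext D y (q + 1)) := by
    simp only [← Finset.sum_add_distrib]
    exact Finset.sum_congr rfl fun q _ => by ring
  rw [h1, h2, a1, a2, a3, a4, zmod2_add_self, zero_add, ← Finset.sum_add_distrib]
  exact Finset.sum_congr rfl fun q _ => by ring

theorem form_comm {D : ℕ} (x y : V D) : form D x y = form D y x := by
  rw [form_eq_sum_range, form_eq_sum_range]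
  exact Finset.sum_congr rfl fun q _ => mul_comm _ _

theorem form_self {D : ℕ} (x : V D) : form D x x = 0 := by
  have h : ∀ a : ZMod 2, a * a = a := by decide
  rw [form_eq_sum_range]
  simp only [h]
  rw [Finset.sum_add_distrib, Finset.sum_range_succ', Finset.sum_range_succ (fun q => ext D x (q + 1)),
    (ext_suppIn x).1, (ext_suppIn x).2 (D + 1) (by omega), add_zero, zmod2_add_self]

/-- Pairing with basis vectors gives `y_p = y_{p+2}`. Zero spreads to even indices from `0` and to
odd ones from `D + 1`; this is where the parity of `D` enters. -/
theorem eq_zero_of_form_eq_zero {D : ℕ} (hD : Even D) {y : V D} (h : ∀ x, form D x y = 0) :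
    y = 0 := by
  have h1 : ∀ p < D, ext D y p = ext D y (p + 2) := by
    intro p hp
    have h2 := h (Pi.single ⟨p, hp⟩ 1)
    rw [form_eq_sum, Finset.sum_eq_single ⟨p, hp⟩] at h2
    · simp only [Pi.single_eq_same, one_mul] at h2
      rw [← add_zero (ext D y p), ← zmod2_add_self (ext D y (p + 2)), ← add_assoc, h2, zero_add]
    · intro i _ hi
      simp [Pi.single_eq_of_ne hi]
    · simp
  obtain ⟨d, rfl⟩ := hD
  have even : ∀ m ≤ d, ext (d + d) y (2 * m) = 0 := by
    intro m
    induction m with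
    | zero => intro _; exact (ext_suppIn y).1
    | succ m ih =>
      intro hm
      rw [mul_add, mul_one, ← h1 (2 * m) (by omega)]
      exact ih (by omega)
  have odd : ∀ m ≤ d, ext (d + d) y (2 * m + 1) = 0 := by
    intro m hm
    induction hm using Nat.decreasingInduction with
    | self => exact (ext_suppIn y).2 _ (by omega)
    | of_succ m hm ih => rw [h1 (2 * m + 1) (by omega)]; exact ih
  apply ext_injective
  rw [map_zero]
  funext p
  rcases Nat.lt_or_ge (d + d) p with hp | hp
  · exact (ext_suppIn y).2 p hp
  · obtain ⟨m, rfl | rfl⟩ := Nat.even_or_odd' p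
    · exact even m (by omega)
    · exact odd m (by omega)

theorem Separated.isotropic {D : ℕ} {B : Finset (ℕ × ℕ)} (hB : Separated D B) :
    Isotropic (bracket D B) := by
  have gen : ∀ I ∈ B, ∀ J ∈ B, form D (eInt D I) (eInt D J) = 0 := by
    intro I hI J hJ
    by_cases hIJ : I = J
    · rw [hIJ, form_self]
    · have bI := hB.bounds I hI
      have bJ := hB.bounds J hJ
      have hd := hB.disj I hI J hJ hIJ
      rw [form_eq_sum_range]
      refine Finset.sum_eq_zero fun q _ => ?_
      rw [ext_eInt bI.1 bI.2.2, ext_eInt bJ.1 bJ.2.2, indic_add_succ bI.2.1, indic_add_succ bJ.2.1]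
      split_ifs <;> first | omega | simp
  intro x hx y hy
  induction hx using Submodule.span_induction with
  | zero => simp
  | add u v _ _ hu hv => simp [hu, hv]
  | smul a u _ hu => simp [hu]
  | mem x hx =>
    obtain ⟨I, hI, rfl⟩ := hx
    induction hy using Submodule.span_induction with
    | zero => simp
    | add u v _ _ hu hv => simp [hu, hv]
    | smul a u _ hu => simp [hu]
    | mem y hy =>
      obtain ⟨J, hJ, rfl⟩ := hy
      exact gen I hI J hJ

/-! ## The identification of `V` with `M(𝒢)` -/

theorem sgn_injective : Function.Injective sgn := by
  intro a b h
  rcases zmod2_cases a with rfl | rfl <;> rcases zmod2_cases b with rfl | rfl <;>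
    first | rfl | (exfalso; norm_num [sgn] at h)

theorem mem_centralizer_of_comm {G : Type} [CommGroup G] (x z : G) :
    z ∈ Subgroup.centralizer ({x} : Set G) := by
  rw [Subgroup.mem_centralizer_singleton_iff, mul_comm]

theorem MPair.Rel.x_eq {G : Type} [CommGroup G] {p q : MPair G} (h : p.Rel q) : p.x = q.x := by
  obtain ⟨g, φ, hx, -⟩ := h
  rw [← hx, mul_comm g, mul_inv_cancel_right]

theorem MPair.Rel.tr_eq {G : Type} [CommGroup G] {p q : MPair G} (h : p.Rel q) (z : G) :
    p.tr z = q.tr z := by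
  obtain ⟨g, φ, hx, h⟩ := h
  rw [MPair.tr, MPair.tr, dif_pos (mem_centralizer_of_comm _ _),
    dif_pos (mem_centralizer_of_comm _ _)]
  have h1 := h ⟨z, mem_centralizer_of_comm _ _⟩ ⟨z, mem_centralizer_of_comm _ _⟩
    (by simp [mul_comm g])
  rw [← LinearMap.trace_conj' (p.ρ _) φ]
  congr 1
  exact LinearMap.ext fun v => by simp [LinearEquiv.conj_apply, h1]

theorem MPair.tr_oneDim {G : Type} [CommGroup G] (x z : G)
    (χ : Subgroup.centralizer ({x} : Set G) →* ℂ) :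
    (MPair.mk x 1 (oneDim χ) (oneDim_irreducible χ)).tr z = χ ⟨z, mem_centralizer_of_comm _ _⟩ := by
  rw [MPair.tr, dif_pos (mem_centralizer_of_comm _ _)]
  change LinearMap.trace ℂ (Fin 1 → ℂ) (χ _ • LinearMap.id) = _
  simp

theorem MPair.pairing_of_comm {G : Type} [CommGroup G] [Finite G] (p q : MPair G) :
    p.pairing q = (Nat.card G : ℂ)⁻¹ * (q.tr p.x⁻¹ * p.tr q.x) := by
  have hc : ∀ x : G, Nat.card (Subgroup.centralizer ({x} : Set G)) = Nat.card G := by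
    intro x
    have : Subgroup.centralizer ({x} : Set G) = ⊤ :=
      (Subgroup.eq_top_iff' _).2 (mem_centralizer_of_comm x)
    rw [this, Subgroup.card_top]
  have : Fintype G := Fintype.ofFinite G
  have hG : (Nat.card G : ℂ) ≠ 0 := Nat.cast_ne_zero.2 Nat.card_pos.ne'
  rw [MPair.pairing, finsum_eq_sum_of_fintype]
  simp only [hc]
  rw [Finset.sum_congr rfl (g := fun _ => (Nat.card G : ℂ)⁻¹ * (Nat.card G : ℂ)⁻¹ *
    (q.tr p.x⁻¹ * p.tr q.x))]
  · rw [Finset.sum_const, Finset.card_univ, ← Nat.card_eq_fintype_card, nsmul_eq_mul]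
    field_simp
  · intro g _
    rw [if_pos (mul_comm _ _), mul_comm g⁻¹, inv_mul_cancel_right, mul_comm g, mul_inv_cancel_right,
      mul_assoc]

/-- An irreducible representation of a finite commutative group, as a pair, is isomorphic to a
one-dimensional one. -/
theorem M.exists_ofChar_eq {G : Type} [CommGroup G] (m : M G) :
    ∃ x χ, M.ofChar (Γ := G) x χ = m := by
  induction m using Quotient.inductionOn with
  | _ p =>
  obtain ⟨x, n, ρ, irr⟩ := p
  have h1 : Module.finrank ℂ (Fin n → ℂ) = 1 :=
    Representation.IsIrreducible.finrank_eq_one_of_isMulCommutative ρ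
  have hn : n = 1 := by simpa using h1
  subst hn
  have hρ : ∀ z v, ρ z v = (ρ z 1 0) • v := by
    intro z v
    have hv : v = v 0 • (1 : Fin 1 → ℂ) := by
      funext i
      rw [Subsingleton.elim i 0]
      simp
    conv_lhs => rw [hv]
    rw [map_smul]
    funext i
    rw [Subsingleton.elim i 0]
    simp [mul_comm]
  refine ⟨x, ⟨⟨fun z => ρ z 1 0, by simp⟩, fun z w => ?_⟩, ?_⟩
  · change ρ (z * w) 1 0 = ρ z 1 0 * ρ w 1 0
    rw [map_mul, Module.End.mul_apply, hρ z (ρ w 1)]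
    rfl
  · refine Quotient.sound ⟨1, LinearEquiv.refl ℂ _, by simp, fun z w h v => ?_⟩
    have hzw : w = z := Subtype.ext (by simpa using h)
    subst hzw
    change ρ w 1 0 • v = ρ w v
    rw [hρ w v]

section decomposition

variable {D : ℕ} {L L' : Submodule (ZMod 2) (V D)} (h : IsCompl L L')

include h in
theorem form_eq_zero_of_form_left_eq_zero (hD : Even D) (hL' : Isotropic L') {y : V D}
    (hy : y ∈ L') (h0 : ∀ l ∈ L, form D l y = 0) : y = 0 := by
  refine eq_zero_of_form_eq_zero hD fun x => ?_
  rw [← Submodule.projection_add_projection_eq_self h x, map_add, LinearMap.add_apply,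
    h0 _ (Submodule.projection_apply_mem h x), hL' _ (Submodule.projection_apply_mem h.symm x) y hy,
    add_zero]

theorem exists_form_eq (hD : Even D) (f : V D →ₗ[ZMod 2] ZMod 2) : ∃ y, ∀ x, form D x y = f x := by
  have hinj : Function.Injective (form D).flip := by
    rw [injective_iff_map_eq_zero]
    intro y hy
    refine eq_zero_of_form_eq_zero hD fun x => ?_
    exact LinearMap.congr_fun hy x
  have hsurj : Function.Surjective (form D).flip :=
    (LinearMap.injective_iff_surjective_of_finrank_eq_finrank
      (Subspace.dual_finrank_eq).symm).1 hinj
  obtain ⟨y, hy⟩ := hsurj f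
  exact ⟨y, fun x => LinearMap.congr_fun hy x⟩

theorem iota_injective (hD : Even D) (hL' : Isotropic L') : Function.Injective (iota h) := by
  intro v w hvw
  have hrel : MPair.Rel _ _ := Quotient.exact hvw
  have hx := hrel.x_eq
  have ht := hrel.tr_eq
  simp only [EmbeddingLike.apply_eq_iff_eq] at hx
  rw [← Submodule.projection_add_projection_eq_self h v,
    ← Submodule.projection_add_projection_eq_self h w]
  have h1 : L.projection L' h v = L.projection L' h w := by
    rw [← Submodule.coe_projectionOnto_apply, ← Submodule.coe_projectionOnto_apply, hx]
  have h2 : L'.projection L h.symm v - L'.projection L h.symm w = 0 := by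
    refine form_eq_zero_of_form_left_eq_zero h hD hL' (sub_mem
      (Submodule.projection_apply_mem h.symm v) (Submodule.projection_apply_mem h.symm w)) ?_
    intro l hl
    have h3 := ht (Multiplicative.ofAdd ⟨l, hl⟩)
    rw [MPair.tr_oneDim, MPair.tr_oneDim] at h3
    have h4 := sgn_injective h3
    rw [map_sub, sub_eq_zero]
    simpa using h4
  rw [h1, sub_eq_zero.1 h2]

theorem iota_surjective (hD : Even D) (hL : Isotropic L) : Function.Surjective (iota h) := by
  intro m
  obtain ⟨x, χ, rfl⟩ := M.exists_ofChar_eq m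
  have hmem : ∀ z : Gp L, z ∈ Subgroup.centralizer ({x} : Set (Gp L)) := mem_centralizer_of_comm x
  have hsq : ∀ z : Subgroup.centralizer ({x} : Set (Gp L)), χ z * χ z = 1 := by
    intro z
    rw [← map_mul]
    have : z * z = 1 := by
      apply Subtype.ext
      apply Multiplicative.toAdd.injective
      apply Subtype.ext
      funext i
      exact zmod2_add_self _
    rw [this, map_one]
  have hcase : ∀ z, ∃ a, χ z = sgn a := by
    intro z
    rcases mul_self_eq_one_iff.1 (hsq z) with h1 | h1
    · exact ⟨0, by simp [h1, sgn]⟩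
    · exact ⟨1, by simp [h1, sgn]⟩
  choose a ha using hcase
  let f : L →+ ZMod 2 := AddMonoidHom.mk' (fun l => a ⟨Multiplicative.ofAdd l, hmem _⟩) (by
    intro l l'
    apply sgn_injective
    rw [sgn_add, ← ha, ← ha, ← ha, ← map_mul]
    rfl)
  -- The character takes values `±1`, so it is the sign of a linear functional on `L`, represented
  -- here by `y`. Only the component of `y` in `L'` matters, because `L` is isotropic.
  obtain ⟨y, hy⟩ := exists_form_eq hD
    ((AddMonoidHom.toZModLinearMap 2 f).comp (L.projectionOnto L' h))
  let l : L := Multiplicative.toAdd x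
  refine ⟨(l : V D) + L'.projection L h.symm y, ?_⟩
  have h1 : L.projectionOnto L' h ((l : V D) + L'.projection L h.symm y) = l := by
    rw [map_add, Submodule.projectionOnto_apply_left,
      Submodule.projectionOnto_apply_of_mem_right h (Submodule.projection_apply_mem h.symm y),
      add_zero]
  have h2 : (L'.projectionOnto L h.symm ((l : V D) + L'.projection L h.symm y) : V D) =
      L'.projection L h.symm y := by
    rw [map_add, Submodule.projectionOnto_apply_of_mem_right h.symm l.2, zero_add,
      Submodule.projectionOnto_apply_of_mem_left h.symm (Submodule.projection_apply_mem h.symm y)]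
  rw [iota, h1, h2]
  change M.ofChar x _ = _
  congr 1
  ext z
  rw [ha]
  change sgn (form D ((Multiplicative.toAdd (z : Gp L) : L) : V D) _) = _
  congr 1
  have h3 := hy (Multiplicative.toAdd (z : Gp L) : L)
  rw [LinearMap.comp_apply, Submodule.projectionOnto_apply_left] at h3
  have h4 := hL _ (Multiplicative.toAdd (z : Gp L) : L).2 _ (Submodule.projection_apply_mem h y)
  rw [← Submodule.projection_add_projection_eq_self h y, map_add, h4, zero_add] at h3
  exact h3

theorem iota_zero : iota h 0 = M.one (Gp L) := by
  rw [iota, map_zero (L.projectionOnto L' h)]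
  change M.ofChar (1 : Gp L) _ = M.ofChar 1 _
  congr 1
  ext z
  change sgn (form D _ ((L'.projectionOnto L h.symm 0 : L') : V D)) = 1
  simp [sgn]

/-- Of the four terms of `(v, w)` only the two mixed ones survive, and these are the two characters
in Lusztig's pairing. -/
theorem pairing_iota (hL : Isotropic L) (hL' : Isotropic L') (v w : V D) :
    MPair.pairing (Quotient.out (iota h v)) (Quotient.out (iota h w)) =
      (Nat.card (Gp L) : ℂ)⁻¹ * sgn (form D v w) := by
  have out_rel : ∀ v, MPair.Rel (Quotient.out (iota h v))
      ⟨_, 1, oneDim (charOf (L'.projectionOnto L h.symm v : V D) _), oneDim_irreducible _⟩ :=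
    fun v => Quotient.exact (Quotient.out_eq (iota h v))
  rw [MPair.pairing_of_comm, (out_rel v).tr_eq, (out_rel w).tr_eq, (out_rel v).x_eq,
    (out_rel w).x_eq, MPair.tr_oneDim, MPair.tr_oneDim]
  congr 1
  have hv := Submodule.projection_add_projection_eq_self h v
  have hw := Submodule.projection_add_projection_eq_self h w
  change sgn (form D (-(L.projectionOnto L' h v : V D)) (L'.projectionOnto L h.symm w : V D)) *
    sgn (form D (L.projectionOnto L' h w : V D) (L'.projectionOnto L h.symm v : V D)) = _
  rw [← sgn_add, Submodule.coe_projectionOnto_apply, Submodule.coe_projectionOnto_apply,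
    Submodule.coe_projectionOnto_apply, Submodule.coe_projectionOnto_apply]
  congr 1
  conv_rhs => rw [← hv, ← hw]
  have e1 := hL _ (Submodule.projection_apply_mem h v) _ (Submodule.projection_apply_mem h w)
  have e2 := hL' _ (Submodule.projection_apply_mem h.symm v) _
    (Submodule.projection_apply_mem h.symm w)
  have hneg : ∀ a : ZMod 2, -a = a := by decide
  simp only [map_add, map_neg, LinearMap.add_apply, LinearMap.neg_apply, e1, e2, zero_add,
    add_zero, hneg]
  rw [form_comm (L.projection L' h w), add_comm]

theorem charFun_iota (hD : Even D) (hL' : Isotropic L') (B : Finset (ℕ × ℕ)) (v : V D) :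
    charFun h B (iota h v) = if v ∈ bracket D B then 1 else 0 := by
  rw [charFun, Finsupp.finsetSum_apply, Finset.sum_eq_single v]
  · split_ifs <;> simp
  · intro w _ hw
    split_ifs
    · rw [Finsupp.single_eq_of_ne]
      exact fun e => hw (iota_injective h hD hL' e.symm)
    · rfl
  · simp

/-- The sum of a character of exponent `2` over a subspace is nonnegative. -/
theorem sum_sgn_nonneg (E : Submodule (ZMod 2) (V D)) (w : V D) :
    ∃ r : ℝ, 0 ≤ r ∧ (∑ v : V D, if v ∈ E then sgn (form D v w) else 0) = r := by
  by_cases hE : ∀ v ∈ E, form D v w = 0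
  · refine ⟨∑ v : V D, if v ∈ E then 1 else 0,
      Finset.sum_nonneg fun v _ => by split_ifs <;> norm_num, ?_⟩
    push_cast
    refine Finset.sum_congr rfl fun v _ => ?_
    split_ifs with hv
    · simp [hE v hv, sgn]
    · simp
  · push Not at hE
    obtain ⟨u, hu, hne⟩ := hE
    refine ⟨0, le_rfl, ?_⟩
    have h1 : form D u w = 1 := (zmod2_cases _).resolve_left hne
    -- Translation by `u` preserves `E` and reverses every sign, so the sum vanishes.
    have h2 : (∑ v : V D, if v ∈ E then sgn (form D v w) else 0) =
        -∑ v : V D, if v ∈ E then sgn (form D v w) else 0 := by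
      rw [← Finset.sum_neg_distrib, ← Equiv.sum_comp (Equiv.addRight u)]
      refine Finset.sum_congr rfl fun v _ => ?_
      have h3 : v + u ∈ E ↔ v ∈ E := Submodule.add_mem_iff_left E hu
      simp only [Equiv.coe_addRight, h3, map_add, LinearMap.add_apply, h1, sgn_add]
      split_ifs <;> simp [sgn]
    rw [Complex.ofReal_zero]
    linear_combination h2 / 2

theorem bipositive_charFun (hD : Even D) (hL : Isotropic L) (hL' : Isotropic L')
    (B : Finset (ℕ × ℕ)) : Bipositive (charFun h B) := by
  constructor
  · intro m
    obtain ⟨v, rfl⟩ := iota_surjective h hD hL m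
    rw [charFun_iota h hD hL']
    split_ifs
    · exact ⟨1, by norm_num, by simp⟩
    · exact ⟨0, le_rfl, by simp⟩
  · intro m
    obtain ⟨w, rfl⟩ := iota_surjective h hD hL m
    obtain ⟨r, hr, hsum⟩ := sum_sgn_nonneg (bracket D B) w
    refine ⟨(Nat.card (Gp L) : ℝ)⁻¹ * r, by positivity, ?_⟩
    rw [fourier, charFun, ← Finsupp.sum_finsetSum_index (by simp) (by intros; ring)]
    push_cast
    rw [← hsum, Finset.mul_sum]
    refine Finset.sum_congr rfl fun v _ => ?_
    split_ifs
    · rw [Finsupp.sum_single_index (by simp), pairing_iota h hL hL', one_mul]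
    · simp

end decomposition

/-! ## Symbols in a family -/

theorem LSymbol.count_entries_le (Λ : LSymbol) (z : ℕ) : Λ.entries.count z ≤ 2 := by
  induction Λ using Sym2.inductionOn with
  | _ A B =>
  change (A.val + B.val).count z ≤ 2
  rw [Multiset.count_add]
  have h1 := Multiset.nodup_iff_count_le_one.1 A.nodup z
  have h2 := Multiset.nodup_iff_count_le_one.1 B.nodup z
  omega

theorem LSymbol.mem_singles {Λ : LSymbol} {z : ℕ} : z ∈ Λ.singles ↔ Λ.entries.count z = 1 := by
  rw [LSymbol.singles, Finset.mem_filter, Multiset.mem_toFinset, ← Multiset.count_pos]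
  omega

theorem LSymbol.mem_doubles {Λ : LSymbol} {z : ℕ} : z ∈ Λ.doubles ↔ Λ.entries.count z = 2 := by
  rw [LSymbol.doubles, Finset.mem_filter, Multiset.mem_toFinset, ← Multiset.count_pos]
  omega

theorem LSymbol.disjoint_doubles_singles (Λ : LSymbol) : Disjoint Λ.doubles Λ.singles := by
  rw [Finset.disjoint_left]
  intro z h1 h2
  rw [LSymbol.mem_doubles] at h1
  rw [LSymbol.mem_singles] at h2
  omega

theorem secondRow_subset (Λ : LSymbol) (x : V (famD Λ)) : secondRow Λ x ⊆ Λ.singles :=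
  Finset.filter_subset _ _

theorem entries_symbolOf (Λ : LSymbol) (x : V (famD Λ)) :
    (symbolOf Λ x).entries = Λ.entries := by
  have hcount : ∀ (S : Finset ℕ) (z : ℕ), S.val.count z = if z ∈ S then 1 else 0 := by
    intro S z
    rw [Multiset.count_eq_of_nodup S.nodup]
    rfl
  ext z
  change ((Λ.doubles ∪ (Λ.singles \ secondRow Λ x)).val + (Λ.doubles ∪ secondRow Λ x).val).count z
    = _
  rw [Multiset.count_add, hcount, hcount]
  simp only [Finset.mem_union, Finset.mem_sdiff]
  have h0 := Λ.count_entries_le z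
  have h1 := LSymbol.mem_doubles (Λ := Λ) (z := z)
  have h2 := LSymbol.mem_singles (Λ := Λ) (z := z)
  by_cases hs : z ∈ secondRow Λ x
  · have h3 := secondRow_subset Λ x hs
    have h4 : z ∉ Λ.doubles := fun h => Finset.disjoint_left.1 Λ.disjoint_doubles_singles h h3
    simp [hs, h4, h2.1 h3]
  · by_cases hd : z ∈ Λ.doubles
    · simp [hd, h1.1 hd]
    · by_cases hz : z ∈ Λ.singles
      · simp [hs, hd, hz, h2.1 hz]
      · simp only [hs, hd, hz]
        rw [h1] at hd
        rw [h2] at hz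
        simp
        omega

theorem card_entries (Λ : LSymbol) :
    Multiset.card Λ.entries = 2 * Λ.doubles.card + Λ.singles.card := by
  rw [← entries_symbolOf Λ 0]
  change Multiset.card ((Λ.doubles ∪ (Λ.singles \ secondRow Λ 0)).val +
    (Λ.doubles ∪ secondRow Λ 0).val) = _
  have hd := Λ.disjoint_doubles_singles
  rw [Multiset.card_add, Finset.card_val, Finset.card_val,
    Finset.card_union_of_disjoint (hd.mono_right Finset.sdiff_subset),
    Finset.card_union_of_disjoint (hd.mono_right (secondRow_subset Λ 0)),
    ← Finset.card_sdiff_add_card_eq_card (secondRow_subset Λ 0)]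
  ring

theorem card_singles_mod_two (Λ : LSymbol) : Λ.singles.card % 2 = Λ.defect % 2 := by
  have h := card_entries Λ
  generalize Λ.singles.card = s at *
  generalize Λ.doubles.card = d at *
  induction Λ using Sym2.inductionOn with
  | _ A B =>
  change Multiset.card (A.val + B.val) = _ at h
  change _ = ((A.card : ℤ) - B.card).natAbs % 2
  rw [Multiset.card_add, Finset.card_val, Finset.card_val] at h
  omega

theorem even_famD (Λ : LSymbol) : Even (famD Λ) := even_two_mul _

theorem LSymbol.pos_injOn (Λ : LSymbol) : Set.InjOn Λ.pos Λ.singles := by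
  have key : ∀ z ∈ Λ.singles, ∀ w ∈ Λ.singles, z < w → Λ.pos z < Λ.pos w := by
    intro z hz w hw hzw
    refine Finset.card_lt_card ⟨fun u hu => ?_, fun hsub => ?_⟩
    · rw [Finset.mem_filter] at hu ⊢
      exact ⟨hu.1, hu.2.trans hzw.le⟩
    · have := (Finset.mem_filter.1 (hsub (Finset.mem_filter.2 ⟨hw, le_rfl⟩))).2
      omega
  intro z hz w hw h
  rcases lt_trichotomy z w with h1 | h1 | h1
  · exact absurd h (key z hz w hw h1).ne
  · exact h1
  · exact absurd h (key w hw z hz h1).ne'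

theorem LSymbol.image_pos (Λ : LSymbol) :
    Λ.singles.image Λ.pos = (Finset.range Λ.singles.card).image (· + 1) := by
  refine Finset.eq_of_subset_of_card_le ?_ ?_
  · intro p hp
    obtain ⟨z, hz, rfl⟩ := Finset.mem_image.1 hp
    have h1 : 0 < Λ.pos z := Finset.card_pos.2 ⟨z, Finset.mem_filter.2 ⟨hz, le_rfl⟩⟩
    have h2 : Λ.pos z ≤ Λ.singles.card := Finset.card_filter_le _ _
    exact Finset.mem_image.2 ⟨Λ.pos z - 1, Finset.mem_range.2 (by omega), by omega⟩
  · rw [Finset.card_image_of_injOn Λ.pos_injOn,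
      Finset.card_image_of_injective _ (add_left_injective 1), Finset.card_range]

theorem row_sum_eq_ext {D : ℕ} (x : V D) (q : ℕ) :
    (∑ i : Fin D, if q + 1 = (i : ℕ) + 1 ∨ q + 1 = i + 2 then x i else 0) =
      ext D x q + ext D x (q + 1) := by
  rw [ext_apply, ext_apply, ← Finset.sum_add_distrib]
  refine Finset.sum_congr rfl fun i _ => ?_
  split_ifs <;> first | omega | simp

theorem stepSign_eq (x : ℕ → ZMod 2) (q : ℕ) : stepSign x q =
    if (if Even (q + 1) then (1 : ZMod 2) else 0) + (x q + x (q + 1)) = 1 then -1 else 1 := by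
  unfold stepSign
  have h1 : sgz 0 = 1 := by decide
  have h2 : sgz 1 = -1 := by decide
  have h3 : (1 + 1 : ZMod 2) = 0 := by decide
  rcases Nat.even_or_odd q with hq | hq
  · have hq' : ¬ Even (q + 1) := by simpa [Nat.even_add_one] using hq
    rcases zmod2_cases (x q + x (q + 1)) with h | h <;> simp [h, hq.neg_one_pow, hq', h1, h2]
  · have hq' : Even (q + 1) := hq.add_one
    rcases zmod2_cases (x q + x (q + 1)) with h | h <;> simp [h, hq.neg_one_pow, hq', h1, h2, h3]

/-- Each single contributes one step, `+1` in the first row and `-1` in the second; `pos` is one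
more than the index of the step. -/
theorem card_rows_sub (Λ : LSymbol) (x : V (famD Λ)) :
    ((Λ.singles \ secondRow Λ x).card : ℤ) - (secondRow Λ x).card =
      walk (ext _ x) Λ.singles.card := by
  have h1 : ((Λ.singles \ secondRow Λ x).card : ℤ) - (secondRow Λ x).card =
      ∑ z ∈ Λ.singles, if z ∈ secondRow Λ x then -1 else 1 := by
    rw [← Finset.sum_sdiff (secondRow_subset Λ x),
      Finset.sum_congr rfl (g := fun _ => (1 : ℤ)),
      Finset.sum_congr (s₁ := secondRow Λ x) rfl (g := fun _ => (-1 : ℤ))]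
    · simp [sub_eq_add_neg]
    · intro z hz; rw [if_pos hz]
    · intro z hz; rw [if_neg (Finset.mem_sdiff.1 hz).2]
  have h2 : ∑ z ∈ Λ.singles, (if z ∈ secondRow Λ x then -1 else 1) =
      ∑ p ∈ Λ.singles.image Λ.pos, stepSign (ext _ x) (p - 1) := by
    rw [Finset.sum_image Λ.pos_injOn]
    refine Finset.sum_congr rfl fun z hz => ?_
    have hpos : 0 < Λ.pos z := Finset.card_pos.2 ⟨z, Finset.mem_filter.2 ⟨hz, le_rfl⟩⟩
    obtain ⟨q, hq⟩ := Nat.exists_eq_succ_of_ne_zero hpos.ne'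
    rw [Nat.succ_eq_add_one] at hq
    rw [hq, Nat.add_sub_cancel, stepSign_eq, ← row_sum_eq_ext, secondRow]
    simp only [Finset.mem_filter, hz, true_and, hq]
  rw [h1, h2, Λ.image_pos, Finset.sum_image (add_left_injective 1).injOn]
  rfl

theorem defect_symbolOf (Λ : LSymbol) (x : V (famD Λ)) :
    (symbolOf Λ x).defect = (walk (ext _ x) Λ.singles.card).natAbs := by
  rw [← card_rows_sub]
  change (((Λ.doubles ∪ (Λ.singles \ secondRow Λ x)).card : ℤ) -
    (Λ.doubles ∪ secondRow Λ x).card).natAbs = _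
  have hd := Λ.disjoint_doubles_singles
  rw [Finset.card_union_of_disjoint (hd.mono_right Finset.sdiff_subset),
    Finset.card_union_of_disjoint (hd.mono_right (secondRow_subset Λ x))]
  congr 1
  push_cast
  ring

/-- The current bit fixes the height modulo `4`. In particular the height at `D + 1` is `1` modulo
`4`, so it cannot be `-1`; type `D` needs this. -/
theorem walk_mod_four {x : ℕ → ZMod 2} (h0 : x 0 = 0) (m : ℕ) :
    (∃ a, walk x (2 * m) = 4 * a + if x (2 * m) = 0 then 0 else 2) ∧
    (∃ a, walk x (2 * m + 1) = 4 * a + if x (2 * m + 1) = 0 then 1 else -1) := by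
  have g0 : sgz 0 = 1 := by decide
  have g1 : sgz 1 = -1 := by decide
  have g2 : (1 + 1 : ZMod 2) = 0 := by decide
  have odd : ∀ m, (∃ a, walk x (2 * m) = 4 * a + if x (2 * m) = 0 then 0 else 2) →
      ∃ a, walk x (2 * m + 1) = 4 * a + if x (2 * m + 1) = 0 then 1 else -1 := by
    rintro m ⟨a, ha⟩
    rw [walk_succ, ha, stepSign, (even_two_mul m).neg_one_pow, one_mul]
    rcases zmod2_cases (x (2 * m)) with h | h <;> rcases zmod2_cases (x (2 * m + 1)) with h' | h' <;>
      simp only [h, h', g0, g1, g2, add_zero, zero_add, if_true, one_ne_zero, if_false]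
    exacts [⟨a, by ring⟩, ⟨a, by ring⟩, ⟨a, by ring⟩, ⟨a + 1, by ring⟩]
  induction m with
  | zero =>
    have := odd 0 ⟨0, by simp [walk_zero, h0]⟩
    exact ⟨⟨0, by simp [walk_zero, h0]⟩, this⟩
  | succ m ih =>
    obtain ⟨a, ha⟩ := ih.2
    have he : ∃ a, walk x (2 * (m + 1)) = 4 * a + if x (2 * (m + 1)) = 0 then 0 else 2 := by
      rw [show 2 * (m + 1) = 2 * m + 1 + 1 by ring, walk_succ, ha, stepSign,
        (odd_two_mul_add_one m).neg_one_pow]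
      rcases zmod2_cases (x (2 * m + 1)) with h | h <;>
        rcases zmod2_cases (x (2 * m + 1 + 1)) with h' | h' <;>
        simp only [h, h', g0, g1, g2, add_zero, zero_add, if_true, one_ne_zero, if_false]
      exacts [⟨a, by ring⟩, ⟨a, by ring⟩, ⟨a, by ring⟩, ⟨a - 1, by ring⟩]
    exact ⟨he, odd _ he⟩

/-- The elements of `V` whose symbols belong to the family. -/
theorem symbolOf_mem_family_iff {t : ClassicalType} {n : ℕ} {Λ : LSymbol}
    (hΛ : IsWeylSymbol t n Λ) (x : V (famD Λ)) :
    symbolOf Λ x ∈ family t n Λ ↔ |balance (famD Λ) (ext _ x) 0| = 1 := by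
  have h1 : symbolOf Λ x ∈ family t n Λ ↔
      (walk (ext _ x) Λ.singles.card).natAbs = t.defect := by
    rw [← defect_symbolOf, family, Set.mem_ofPred_eq, IsWeylSymbol, entries_symbolOf]
    exact ⟨fun h => h.1.2.2, fun h => ⟨⟨hΛ.1, hΛ.2.1, h⟩, rfl⟩⟩
  have hpar := card_singles_mod_two Λ
  rw [hΛ.2.2] at hpar
  have hsupp := ext_suppIn x
  rw [h1, balance_zero, abs_neg]
  generalize ext _ x = y at hsupp ⊢
  have hD : famD Λ = 2 * ((Λ.singles.card - 1) / 2) := rfl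
  obtain ⟨a, ha⟩ := (walk_mod_four hsupp.1 ((Λ.singles.card - 1) / 2)).2
  rw [← hD, hsupp.2 _ (Nat.lt_succ_self _), if_pos rfl] at ha
  have hlast : stepSign y (famD Λ + 1) = -1 := by
    rw [stepSign, hsupp.2 _ (by omega), hsupp.2 _ (by omega), (even_famD Λ).add_one.neg_one_pow]
    decide
  have hodd : Λ.singles.card % 2 = 1 → ((walk y Λ.singles.card).natAbs = 1 ↔
      |walk y (famD Λ + 1)| = 1) := by
    intro h
    rw [show famD Λ + 1 = Λ.singles.card by omega, Int.abs_eq_natAbs]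
    omega
  have heven : Λ.singles.card % 2 = 0 → ((walk y Λ.singles.card).natAbs = 0 ↔
      |walk y (famD Λ + 1)| = 1) := by
    intro h
    have habs := int_abs_cases (walk y (famD Λ + 1))
    -- Without singles `D = 0` and both sides hold. Otherwise there are `D + 2` singles, and the
    -- extra last step is `-1`, so defect `0` means height `1` at `D + 1`.
    rcases Nat.eq_zero_or_pos Λ.singles.card with h0 | h0
    · have hw : walk y (famD Λ + 1) = 1 := by
        have hD0 : famD Λ = 0 := by omega
        rw [hD0, walk_succ, walk_zero, stepSign, hsupp.1, hsupp.2 _ (by omega)]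
        decide
      rw [h0, walk_zero, hw]
      simp
    · rw [show Λ.singles.card = famD Λ + 1 + 1 by omega, walk_succ, hlast]
      omega
  cases t
  · exact hodd hpar
  · exact hodd hpar
  · exact heven hpar

/-! ## Unitriangular families -/

/-- The matrix of the family `hat` is unitriangular with respect to the rank function `r`. -/
structure Unitriangular {X : Type} (hat : X → (X →₀ ℂ)) (r : X → ℕ) : Prop where
  diag : ∀ m, hat m m = 1
  lt : ∀ m m', hat m' m ≠ 0 → m = m' ∨ r m < r m'

namespace Unitriangular

variable {X : Type} {hat : X → (X →₀ ℂ)} {r : X → ℕ} (h : Unitriangular hat r)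
include h

theorem diag_ne_zero (m : X) : hat m m ≠ 0 := by rw [h.diag]; exact one_ne_zero

theorem mem_of_mem_supported {A : Set X} {m : X} (hm : hat m ∈ Finsupp.supported ℂ ℂ A) : m ∈ A :=
  hm (Finsupp.mem_support_iff.2 (h.diag_ne_zero m))

/-- Solving the triangular system by induction on `r` never leaves a set closed under occurrence.
The whole space and the span of `M₀` are both instances. -/
theorem span_image {A : Set X} (hA : ∀ m' ∈ A, ∀ m, hat m' m ≠ 0 → m ∈ A) :
    Submodule.span ℂ (hat '' A) = Finsupp.supported ℂ ℂ A := by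
  apply le_antisymm
  · rw [Submodule.span_le]
    rintro _ ⟨m', hm', rfl⟩ m hm
    exact hA m' hm' m (Finsupp.mem_support_iff.1 hm)
  · rw [Finsupp.supported_eq_span_single, Submodule.span_le]
    rintro _ ⟨m, hm, rfl⟩
    induction hr : r m using Nat.strong_induction_on generalizing m with
    | _ n ih =>
    have h1 : hat m = Finsupp.single m 1 +
        ∑ m' ∈ (hat m).support.erase m, hat m m' • Finsupp.single m' (1 : ℂ) := by
      conv_lhs => rw [← Finsupp.sum_single (hat m), Finsupp.sum,
        ← Finset.add_sum_erase _ _ (Finsupp.mem_support_iff.2 (h.diag_ne_zero m))]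
      rw [h.diag]
      congr 1
      exact Finset.sum_congr rfl fun m' _ => by simp
    change Finsupp.single m 1 ∈ _
    rw [eq_sub_of_add_eq h1.symm]
    refine sub_mem (Submodule.subset_span ⟨m, hm, rfl⟩) (Submodule.sum_mem _ fun m' hm' => ?_)
    obtain ⟨hne, hs⟩ := Finset.mem_erase.1 hm'
    have h2 := Finsupp.mem_support_iff.1 hs
    exact Submodule.smul_mem _ _
      (ih (r m') (hr ▸ (h.lt m' m h2).resolve_left hne) m' (hA m hm m' h2) rfl)

theorem span_range : Submodule.span ℂ (Set.range hat) = ⊤ := by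
  rw [← Set.image_univ, h.span_image (A := Set.univ) (fun _ _ _ _ => trivial), Finsupp.supported_univ]

theorem linearIndependent [Finite X] : LinearIndependent ℂ hat := by
  have := Fintype.ofFinite X
  refine linearIndependent_of_top_le_span_of_card_eq_finrank h.span_range.ge ?_
  simp

theorem transGen {m m' : X} (hm : Relation.TransGen (fun m m' => hat m' m ≠ 0) m m') :
    m = m' ∨ r m < r m' := by
  induction hm with
  | single h1 => exact h.lt _ _ h1
  | tail _ h2 ih =>
    rcases ih with rfl | h3
    · exact h.lt _ _ h2
    · rcases h.lt _ _ h2 with rfl | h4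
      · exact Or.inr h3
      · exact Or.inr (h3.trans h4)

theorem isPartialOrder :
    IsPartialOrder X (Relation.TransGen fun m m' => hat m' m ≠ 0) where
  refl m := Relation.TransGen.single (h.diag_ne_zero m)
  trans _ _ _ := Relation.TransGen.trans
  antisymm a b h1 h2 := by
    rcases h.transGen h1 with h3 | h3
    · exact h3
    · rcases h.transGen h2 with h4 | h4
      · exact h4.symm
      · exact absurd h3 h4.not_gt

theorem exists_numbering [Finite X] :
    ∃ (N : ℕ) (num : Fin N ≃ X), ∀ i j, hat (num j) (num i) ≠ 0 → i ≤ j := by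
  have := Fintype.ofFinite X
  let e := (Fintype.equivFin X).symm
  refine ⟨_, (Tuple.sort (r ∘ e)).trans e, fun i j hij => ?_⟩
  have hmono := Tuple.monotone_sort (r ∘ e)
  rcases h.lt _ _ hij with h1 | h1
  · exact (Equiv.injective _ h1).le
  · by_contra hlt
    exact absurd (hmono (not_le.1 hlt).le) h1.not_ge

/-- A permutation that is nonzero on the matrix of a unitriangular family is trivial. -/
theorem perm_eq_one [Finite X] {σ : Equiv.Perm X} (hσ : ∀ m, hat (σ m) m ≠ 0) : σ = 1 := by
  have hle : ∀ m, r m ≤ r (σ m) := fun m => by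
    rcases h.lt _ _ (hσ m) with h1 | h1
    · rw [← h1]
    · exact h1.le
  have := Fintype.ofFinite X
  -- A permutation that nowhere lowers `r` preserves it, since the sums agree; then the strict
  -- alternative in `lt` is excluded.
  have hsum : ∑ m, r m = ∑ m, r (σ m) := (Equiv.sum_comp σ r).symm
  have heq := (Finset.sum_eq_sum_iff_of_le fun m _ => hle m).1 hsum
  ext m
  rcases h.lt _ _ (hσ m) with h1 | h1
  · exact h1.symm
  · exact absurd (heq m (Finset.mem_univ m)) h1.ne

end Unitriangular

/-! ## The new basis -/

section basis

variable {D : ℕ} {L L' : Submodule (ZMod 2) (V D)} (h : IsCompl L L')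

/-- The element of `𝕊_D` with leading vector `v`. -/
def leadingSet (D : ℕ) (v : V D) : Finset (ℕ × ℕ) :=
  if hB : ∃ B, IsLeading D B (ext D v) then hB.choose else ∅

theorem isLeading_leadingSet (hD : Even D) (v : V D) : IsLeading D (leadingSet D v) (ext D v) := by
  have hB := exists_isLeading hD (ext_suppIn v)
  rw [leadingSet, dif_pos hB]
  exact hB.choose_spec

theorem IsLeading.exists_leadingSet_eq {B : Finset (ℕ × ℕ)} {x : ℕ → ZMod 2}
    (hB : IsLeading D B x) : ∃ v, ext D v = x ∧ leadingSet D v = B := by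
  obtain ⟨v, rfl⟩ := exists_ext_eq hB.suppIn
  exact ⟨v, rfl, (isLeading_leadingSet hB.even v).unique hB⟩

/-- The sum of the absolute values of the balances of `v`. -/
def totalBalance (D : ℕ) (v : V D) : ℕ :=
  ∑ p ∈ Finset.range (D + 2), (balance D (ext D v) p).natAbs

theorem abs_balance_le_of_mem_bracket (hD : Even D) {v w : V D}
    (hw : w ∈ bracket D (leadingSet D v)) {p : ℕ} (hp : p ≤ D + 1) :
    |balance D (ext D w) p| ≤ |balance D (ext D v) p| := by
  have hv := isLeading_leadingSet hD v
  exact hv.abs_balance_le ((ext_mem_seqSpan hv.sd.separated).2 hw) hp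

theorem totalBalance_lt (hD : Even D) {v w : V D} (hw : w ∈ bracket D (leadingSet D v))
    (hne : w ≠ v) : totalBalance D w < totalBalance D v := by
  have hle : ∀ p ∈ Finset.range (D + 2),
      (balance D (ext D w) p).natAbs ≤ (balance D (ext D v) p).natAbs := by
    intro p hp
    have := abs_balance_le_of_mem_bracket hD hw (Nat.le_of_lt_succ (Finset.mem_range.1 hp))
    rwa [Int.abs_eq_natAbs, Int.abs_eq_natAbs, Int.ofNat_le] at this
  refine lt_of_le_of_ne (Finset.sum_le_sum hle) fun heq => hne ?_
  have heq' := (Finset.sum_eq_sum_iff_of_le hle).1 heq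
  refine ext_injective D (eq_of_abs_balance_eq hD (ext_suppIn w) (ext_suppIn v) fun p hp => ?_)
  rw [Int.abs_eq_natAbs, Int.abs_eq_natAbs, heq' p (Finset.mem_range.2 (by omega))]

/-- The element of the new basis attached to an element of `M(𝒢)`. -/
def newElement (m : M (Gp L)) : M (Gp L) →₀ ℂ :=
  charFun h (leadingSet D (Function.invFun (iota h) m))

theorem newElement_iota (hD : Even D) (hL' : Isotropic L') (v : V D) :
    newElement h (iota h v) = charFun h (leadingSet D v) := by
  rw [newElement, Function.leftInverse_invFun (iota_injective h hD hL')]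

theorem newElement_iota_iota (hD : Even D) (hL' : Isotropic L') (v w : V D) :
    newElement h (iota h v) (iota h w) = if w ∈ bracket D (leadingSet D v) then 1 else 0 := by
  rw [newElement_iota h hD hL', charFun_iota h hD hL']

theorem unitriangular_newElement (hD : Even D) (hL : Isotropic L) (hL' : Isotropic L') :
    Unitriangular (newElement h) fun m => totalBalance D (Function.invFun (iota h) m) := by
  constructor
  · intro m
    obtain ⟨v, rfl⟩ := iota_surjective h hD hL m
    have hv := isLeading_leadingSet hD v
    rw [newElement_iota_iota h hD hL',
      if_pos ((ext_mem_seqSpan hv.sd.separated).1 hv.mem)]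
  · intro m m' hne
    obtain ⟨v, rfl⟩ := iota_surjective h hD hL m'
    obtain ⟨w, rfl⟩ := iota_surjective h hD hL m
    rw [newElement_iota_iota h hD hL', ite_ne_right_iff] at hne
    simp only [Function.leftInverse_invFun (iota_injective h hD hL') _]
    by_cases hwv : w = v
    · exact Or.inl (by rw [hwv])
    · exact Or.inr (totalBalance_lt hD hne.1 hwv)

theorem range_newElement (hD : Even D) (hL : Isotropic L) (hL' : Isotropic L') :
    Set.range (newElement h) = newBasis h := by
  ext f
  constructor
  · rintro ⟨m, rfl⟩
    obtain ⟨v, rfl⟩ := iota_surjective h hD hL m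
    exact ⟨_, (isLeading_leadingSet hD v).sd, newElement_iota h hD hL' v⟩
  · rintro ⟨B, hB, rfl⟩
    obtain ⟨x, hx⟩ := hB.exists_isLeading
    obtain ⟨v, -, hv⟩ := hx.exists_leadingSet_eq
    exact ⟨iota h v, by rw [newElement_iota h hD hL', hv]⟩

theorem image_newElement (hD : Even D) (hL' : Isotropic L') :
    newElement h '' (iota h '' {v | |balance D (ext D v) 0| = 1}) = oldBasis h := by
  ext f
  constructor
  · rintro ⟨_, ⟨v, hv, rfl⟩, rfl⟩
    exact ⟨_, (isLeading_leadingSet hD v).sd₀ hv, newElement_iota h hD hL' v⟩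
  · rintro ⟨B, hB, rfl⟩
    obtain ⟨x, hx, hx0⟩ := hB.exists_isLeading
    obtain ⟨v, rfl, hv⟩ := hx.exists_leadingSet_eq
    exact ⟨_, ⟨v, hx0, rfl⟩, by rw [newElement_iota h hD hL', hv]⟩

/-- The absolute balance at `0` is at least `1` and is bounded by that of the leading vector, so the
value `1` is inherited. -/
theorem mem_of_newElement_ne_zero (hD : Even D) (hL : Isotropic L) (hL' : Isotropic L') :
    ∀ m' ∈ iota h '' {v | |balance D (ext D v) 0| = 1}, ∀ m, newElement h m' m ≠ 0 →
      m ∈ iota h '' {v | |balance D (ext D v) 0| = 1} := by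
  rintro _ ⟨v, hv, rfl⟩ m hm
  obtain ⟨w, rfl⟩ := iota_surjective h hD hL m
  rw [newElement_iota_iota h hD hL', ite_ne_right_iff] at hm
  refine ⟨w, le_antisymm ?_ (one_le_abs_balance hD _ 0), rfl⟩
  exact (abs_balance_le_of_mem_bracket hD hm.1 (Nat.zero_le _)).trans hv.le

include h in
theorem finite_M (hD : Even D) (hL : Isotropic L) : Finite (M (Gp L)) :=
  Finite.of_surjective _ (iota_surjective h hD hL)

theorem charFun_one (hD : Even D) (hL' : Isotropic L') (B : Finset (ℕ × ℕ)) :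
    charFun h B (M.one (Gp L)) = 1 := by
  rw [← iota_zero h, charFun_iota h hD hL', if_pos (zero_mem _)]

theorem exists_int_newElement (hD : Even D) (hL : Isotropic L) (hL' : Isotropic L')
    (m m' : M (Gp L)) : ∃ a : ℤ, newElement h m' m = a := by
  obtain ⟨v, rfl⟩ := iota_surjective h hD hL m'
  obtain ⟨w, rfl⟩ := iota_surjective h hD hL m
  rw [newElement_iota_iota h hD hL']
  split_ifs
  · exact ⟨1, by simp⟩
  · exact ⟨0, by simp⟩

end basis

end

end UnipotentBasis
-- The theorem for a family
open UnipotentBasis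
theorem mainTheorem4 (t : ClassicalType) (n : ℕ) (hn : t.minRank ≤ n)
    (Λ : LSymbol) (hΛ : IsWeylSymbol t n Λ)
    (L L' : Submodule (ZMod 2) (V (famD Λ))) (hLL' : IsCompl L L')
    (hL : Isotropic L) (hL' : Isotropic L') :
    -- the new elements form a basis of `ℂ[M(𝒢)]`
    (LinearIndependent ℂ (Subtype.val : newBasis hLL' → (M (Gp L) →₀ ℂ)) ∧
      Submodule.span ℂ (newBasis hLL') = ⊤) ∧
    -- (I)
    (∀ B, SD (famD Λ) B → Isotropic (bracket (famD Λ) B)) ∧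
    (∀ f ∈ newBasis hLL', Bipositive f) ∧
    -- (II)
    (∃ hat : M (Gp L) ≃ newBasis hLL',
      (∀ m, (hat m : M (Gp L) →₀ ℂ) m ≠ 0) ∧
      (∀ hat' : M (Gp L) ≃ newBasis hLL',
        (∀ m, (hat' m : M (Gp L) →₀ ℂ) m ≠ 0) → hat' = hat) ∧
      (∀ m, (hat m : M (Gp L) →₀ ℂ) m = 1) ∧
      -- (III)
      IsPartialOrder (M (Gp L)) (coeffOrder fun m => (hat m : M (Gp L) →₀ ℂ)) ∧
      (∀ m, (∀ m', coeffOrder (fun m => (hat m : M (Gp L) →₀ ℂ)) m' m → m' = m) ↔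
        m = M.one (Gp L)) ∧
      (∃ (N : ℕ) (num : Fin N ≃ M (Gp L)), ∀ i j,
        (hat (num j) : M (Gp L) →₀ ℂ) (num i) ≠ 0 → i ≤ j) ∧
      (∀ m m', ∃ a : ℤ, (hat m' : M (Gp L) →₀ ℂ) m = a)) ∧
    -- (IV)
    (∀ f ∈ newBasis hLL', f (M.one (Gp L)) = 1) ∧
    -- (V)
    newBasis hLL' ∩ (Finsupp.supported ℂ ℂ (M₀ t n Λ hLL') : Set (M (Gp L) →₀ ℂ)) =
      oldBasis hLL' ∧
    LinearIndependent ℂ (Subtype.val : oldBasis hLL' → (M (Gp L) →₀ ℂ)) ∧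
    Submodule.span ℂ (oldBasis hLL') = Finsupp.supported ℂ ℂ (M₀ t n Λ hLL') := by
  have hD := even_famD Λ
  have hU := unitriangular_newElement hLL' hD hL hL'
  have hfin := finite_M hLL' hD hL
  have hrange := range_newElement hLL' hD hL hL'
  have hM₀ : M₀ t n Λ hLL' = iota hLL' '' {v | |balance (famD Λ) (ext (famD Λ) v) 0| = 1} := by
    rw [M₀]
    congr 1
    exact Set.ext fun x => symbolOf_mem_family_iff hΛ x
  have hclosed := mem_of_newElement_ne_zero hLL' hD hL hL'
  have hold := image_newElement hLL' hD hL'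
  rw [← hM₀] at hclosed hold
  have hli : LinearIndependent ℂ (Subtype.val : newBasis hLL' → (M (Gp L) →₀ ℂ)) := by
    rw [← hrange]
    exact hU.linearIndependent.linearIndepOn_id
  have hsub : oldBasis hLL' ⊆ newBasis hLL' := by
    rw [← hold, ← hrange]
    exact Set.image_subset_range _ _
  have hone : ∀ f ∈ newBasis hLL', f (M.one (Gp L)) = 1 := by
    rintro _ ⟨B, -, rfl⟩
    exact charFun_one hLL' hD hL' B
  let hat : M (Gp L) ≃ newBasis hLL' :=
    (Equiv.ofInjective _ hU.linearIndependent.injective).trans (Equiv.setCongr hrange)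
  have hhat : ∀ m, (hat m : M (Gp L) →₀ ℂ) = newElement hLL' m := fun _ => rfl
  refine ⟨⟨hli, ?_⟩, fun B hB => hB.separated.isotropic, ?_,
    ⟨hat, hU.diag_ne_zero, ?_, hU.diag, hU.isPartialOrder, ?_, hU.exists_numbering, ?_⟩, hone, ?_,
    LinearIndepOn.mono (v := id) hli hsub, ?_⟩
  · rw [← hrange, hU.span_range]
  · rintro _ ⟨B, -, rfl⟩
    exact bipositive_charFun hLL' hD hL hL' B
  · intro hat' hne
    have hσ : hat'.trans hat.symm = 1 := hU.perm_eq_one fun m => by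
      have h1 : hat ((hat'.trans hat.symm) m) = hat' m := hat.apply_symm_apply _
      rw [← hhat, h1]
      exact hne m
    refine Equiv.ext fun m => ?_
    have := Equiv.congr_fun hσ m
    rwa [Equiv.trans_apply, Equiv.symm_apply_eq] at this
  -- Since `(1, 1)` occurs in every basis element it lies below everything, so antisymmetry makes it
  -- the only minimal element.
  · have hbot : ∀ m, coeffOrder (fun m => (hat m : M (Gp L) →₀ ℂ)) (M.one (Gp L)) m := by
      refine fun m => Relation.TransGen.single ?_
      rw [hone _ (hat m).2]
      exact one_ne_zero
    refine fun m => ⟨fun hm => (hm _ (hbot m)).symm, ?_⟩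
    rintro rfl m' hm'
    exact hU.isPartialOrder.antisymm _ _ hm' (hbot m')
  · exact exists_int_newElement hLL' hD hL hL'
  · rw [← hrange, ← hold]
    ext f
    constructor
    · rintro ⟨⟨m, rfl⟩, hm⟩
      exact ⟨m, hU.mem_of_mem_supported hm, rfl⟩
    · rintro ⟨m, hm, rfl⟩
      refine ⟨⟨m, rfl⟩, fun m' hm' => ?_⟩
      exact hclosed m hm m' (Finsupp.mem_support_iff.1 hm')
  · rw [← hold, hU.span_image hclosed]
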